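/- Let $r\ge 2$, $n\ge 2$, $g\ge 1$, let $0=\gamma_0<\gamma_1<\dots<\gamma_g$ be integers, $\Lambda=\{\gamma_1,\dots,\gamma_g\}$, and let $p_1,\dots,p_n\ge 0$ be real weights. The level $\ell(v)$ of a node $v$ of a rooted tree is the number of edges from the root to $v$. The *given-lengths reserved-length problem* asks for an $r$-ary tree $T$ (every internal node has at most $r$ children) with exactly $n$ leaves $v_1,\dots,v_n$, all on levels in $\Lambda$, that minimizes $\mathrm{Cost}(T)=\sum_j \ell(v_j)\,p_j$. A *generalized mixed radix (GMR) tree* for $(r_1,\dots,r_g)$ and $(c_1,\dots,c_g)$ is a tree in which every internal node at level $i-1$, $1\le i\le g$, has at most $r_i$ children, joined to it by edges of length $c_i$, and in which nodes on level $g$ are leaves; its cost is $\sum_j \mathrm{depth}(v_j)\,p_j$, where $\mathrm{depth}(v)=\sum_{i\le \ell(v)}c_i$. Put $r_i=r^{\gamma_i-\gamma_{i-1}}$ and $c_i=\gamma_i-\gamma_{i-1}$ for $1\le i\le g$. Say that an $r$-ary tree $T$ and a GMR tree $T'$, each with $n$ labelled leaves, *correspond* if, for $0\le i\le g$, the nodes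 of $T'$ on level $i$ are in bijection with the nodes of $T$ on level $\gamma_i$, in such a way that (for $i\ge 1$) a node $u$ on level $i-1$ of $T'$ is the parent of a node $v$ on level $i$ if and only if the node of $T$ corresponding to $u$ is an ancestor of the one corresponding to $v$, and leaves of $T$ and $T'$ with the same label correspond to each other. Then: 1. Every $r$-ary tree with $n$ leaves, all on levels in $\Lambda$, corresponds to some GMR tree with $n$ leaves for the above parameters, and conversely every such GMR tree corresponds to some $r$-ary tree with $n$ leaves, all on levels in $\Lambda$. Corresponding trees have equal cost, and one is of minimum cost (for its problem) if and only if the other is. 2. There is an algorithm which, given $r,n,g,\gamma_1,\dots,\gamma_g$ and weights $p_1\ge p_2\ge\dots\ge p_n\ge 0$, solves the problem in $O(gn^2)$ steps, with an absolute implied constant, on a unit-cost random access machine with integer and real cells (operations: addition, subtraction and comparison of integers; addition, subtraction, multiplication and comparison of reals; conversion of integers to reals). It decides whether a tree satisfying the constraints exists and, if so, outputs the minimum cost and the leaf sequence of an optimal tree, that is, the number of its leaves on each level $\gamma_1,\dots,\gamma_g$; this is also the leaf sequence (number of leaves on levels $1,\dots,g$) of a corresponding optimal GMR tree. -/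

import Mathlib

noncomputable section

namespace ReservedLength

/-! ### Trees -/

/-- A finite rooted tree with exactly `n` leaves `v_1, …, v_n` (`leaf`). A node is the word of child
slots read on the path from the root; the root is `[]`, and the children of `v` are the nodes
`v ++ [a]`. The level of `v` is `v.length`. -/
structure LabelledTree (n : ℕ) where
  nodes : Finset (List ℕ)
  root_mem : [] ∈ nodes
  parent_mem : ∀ v a, v ++ [a] ∈ nodes → v ∈ nodes
  leaf : Fin n → List ℕ
  leaf_injective : Function.Injective leaf
  mem_range_leaf : ∀ v, v ∈ Set.range leaf ↔ v ∈ nodes ∧ ∀ a, v ++ [a] ∉ nodes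

/-- Generalized mixed radix trees: an internal node at level `i` has at most `R i` children, which
occupy child slots `0, …, R i - 1`. (Indices are shifted by one: `R i` is `r_{i+1}`.) -/
def IsGMR {n : ℕ} (R : ℕ → ℕ) (T : LabelledTree n) : Prop :=
  ∀ v a, v ++ [a] ∈ T.nodes → a < R v.length

/-- The depth of a node when every edge from level `i` to level `i + 1` has length `c i`. -/
def depth (c : ℕ → ℝ) (v : List ℕ) : ℝ := ∑ i ∈ Finset.range v.length, c i

/-- `Cost(T) = ∑_j depth(v_j) p_j`. -/
def gmrCost {n : ℕ} (c : ℕ → ℝ) (p : Fin n → ℝ) (T : LabelledTree n) : ℝ :=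
  ∑ j, depth c (T.leaf j) * p j

/-- `r`-ary trees: every internal node has its children in the slots `0, …, r - 1`. -/
def IsRary {n : ℕ} (r : ℕ) (T : LabelledTree n) : Prop :=
  ∀ v a, v ++ [a] ∈ T.nodes → a < r

/-- The weighted external path length `∑_j ℓ(v_j) p_j`. -/
def pathCost {n : ℕ} (p : Fin n → ℝ) (T : LabelledTree n) : ℝ :=
  ∑ j, ((T.leaf j).length : ℝ) * p j

/-- `Level(T)`, the set of levels of the leaves of `T`. -/
def leafLevels {n : ℕ} (T : LabelledTree n) : Set ℕ :=
  Set.range fun j => (T.leaf j).length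

/-- The number of leaves of `T` on level `l`. -/
def leafCount {n : ℕ} (T : LabelledTree n) (l : ℕ) : ℕ :=
  (Finset.univ.filter fun j => (T.leaf j).length = l).card

/-- `T` has minimum cost among the trees satisfying `F`. -/
def IsOptimal {n : ℕ} (F : LabelledTree n → Prop) (cost : LabelledTree n → ℝ)
    (T : LabelledTree n) : Prop :=
  F T ∧ ∀ S, F S → cost T ≤ cost S

/-! ### The given-lengths reserved-length problem -/

/-- An instance: alphabet size `r`, number of code words `n`, permitted lengths
`γ 1 < ⋯ < γ g` with the convention `γ 0 = 0` (values of `γ` beyond `g` play no role), and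
nonnegative weights `p`. -/
structure Problem where
  r : ℕ
  n : ℕ
  g : ℕ
  γ : ℕ → ℕ
  p : Fin n → ℝ
  two_le_r : 2 ≤ r
  two_le_n : 2 ≤ n
  one_le_g : 1 ≤ g
  γ_zero : γ 0 = 0
  γ_lt : ∀ i < g, γ i < γ (i + 1)
  p_nonneg : ∀ j, 0 ≤ p j

/-- `Λ = {γ_1, …, γ_g}`. -/
def Problem.lengths (I : Problem) : Set ℕ := {l | ∃ i, 1 ≤ i ∧ i ≤ I.g ∧ l = I.γ i}

/-- `r`-ary trees with `n` leaves, all of them on levels in `Λ`. -/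
def Problem.Feasible (I : Problem) (T : LabelledTree I.n) : Prop :=
  IsRary I.r T ∧ leafLevels T ⊆ I.lengths

/-- `r_{i+1} = r ^ (γ_{i+1} - γ_i)` for `i < g`; nodes on level `g` have no children. -/
def Problem.arity (I : Problem) (i : ℕ) : ℕ :=
  if i < I.g then I.r ^ (I.γ (i + 1) - I.γ i) else 0

/-- `c_{i+1} = γ_{i+1} - γ_i`. -/
def Problem.edgeLength (I : Problem) (i : ℕ) : ℝ := (I.γ (i + 1) : ℝ) - (I.γ i : ℝ)

/-- `T` is a minimum-cost `r`-ary tree with `n` leaves and `Level(T) ⊆ Λ`. -/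
def Problem.IsOptimalTree (I : Problem) (T : LabelledTree I.n) : Prop :=
  IsOptimal I.Feasible (pathCost I.p) T

/-- `T'` is a minimum-cost GMR tree with `n` leaves for the arities and edge lengths above. -/
def Problem.IsOptimalGMR (I : Problem) (T' : LabelledTree I.n) : Prop :=
  IsOptimal (IsGMR I.arity) (gmrCost I.edgeLength I.p) T'

/-- The nodes of `T'` on level `i` are in 1-1 correspondence (through `φ`) with the nodes of `T` on
level `γ_i`; there is an edge from `u` on level `i` to `v` on level `i + 1` in `T'` exactly if
`φ u` is an ancestor of `φ v` in `T`; and leaves with the same label correspond. -/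
def Problem.Corresponds (I : Problem) (T T' : LabelledTree I.n) : Prop :=
  ∃ φ : List ℕ → List ℕ,
    Set.BijOn φ {v | v ∈ T'.nodes} {w | w ∈ T.nodes ∧ ∃ i ≤ I.g, w.length = I.γ i} ∧
    (∀ v ∈ T'.nodes, v.length ≤ I.g ∧ (φ v).length = I.γ v.length) ∧
    (∀ u ∈ T'.nodes, ∀ v ∈ T'.nodes, v.length = u.length + 1 →
      ((∃ a, v = u ++ [a]) ↔ φ u <+: φ v)) ∧
    ∀ j, φ (T'.leaf j) = T.leaf j

/-! ### A random access machine with integer and real cells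

Programs are structured programs over finitely many named arrays of natural numbers and of real
numbers (scalars are cells of an array). Every evaluation of a constant, memory access, arithmetic
operation, comparison, assignment or test costs one step. Natural numbers can only be added,
subtracted (truncated at 0) and compared; real numbers can be added, subtracted, multiplied and
compared, and there is no conversion from real to natural numbers. -/

/-- The memory: array name, then index. -/
structure State where
  nat : ℕ → ℕ → ℕ
  real : ℕ → ℕ → ℝ

inductive NatExp where
  | const (k : ℕ)
  | get (a : ℕ) (i : NatExp)
  | add (e₁ e₂ : NatExp)
  | sub (e₁ e₂ : NatExp)

def NatExp.eval (s : State) : NatExp → ℕ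
  | const k => k
  | get a i => s.nat a (i.eval s)
  | add e₁ e₂ => e₁.eval s + e₂.eval s
  | sub e₁ e₂ => e₁.eval s - e₂.eval s

def NatExp.time : NatExp → ℕ
  | const _ => 1
  | get _ i => i.time + 1
  | add e₁ e₂ => e₁.time + e₂.time + 1
  | sub e₁ e₂ => e₁.time + e₂.time + 1

inductive RealExp where
  | ofNat (e : NatExp)
  | get (a : ℕ) (i : NatExp)
  | add (e₁ e₂ : RealExp)
  | sub (e₁ e₂ : RealExp)
  | mul (e₁ e₂ : RealExp)

def RealExp.eval (s : State) : RealExp → ℝ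
  | ofNat e => (e.eval s : ℝ)
  | get a i => s.real a (i.eval s)
  | add e₁ e₂ => e₁.eval s + e₂.eval s
  | sub e₁ e₂ => e₁.eval s - e₂.eval s
  | mul e₁ e₂ => e₁.eval s * e₂.eval s

def RealExp.time : RealExp → ℕ
  | ofNat e => e.time + 1
  | get _ i => i.time + 1
  | add e₁ e₂ => e₁.time + e₂.time + 1
  | sub e₁ e₂ => e₁.time + e₂.time + 1
  | mul e₁ e₂ => e₁.time + e₂.time + 1

inductive Test where
  | natLe (e₁ e₂ : NatExp)
  | realLe (e₁ e₂ : RealExp)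
  | neg (b : Test)
  | conj (b₁ b₂ : Test)

def Test.Holds (s : State) : Test → Prop
  | natLe e₁ e₂ => e₁.eval s ≤ e₂.eval s
  | realLe e₁ e₂ => e₁.eval s ≤ e₂.eval s
  | neg b => ¬ b.Holds s
  | conj b₁ b₂ => b₁.Holds s ∧ b₂.Holds s

def Test.time : Test → ℕ
  | natLe e₁ e₂ => e₁.time + e₂.time + 1
  | realLe e₁ e₂ => e₁.time + e₂.time + 1
  | neg b => b.time + 1
  | conj b₁ b₂ => b₁.time + b₂.time + 1

inductive Program where
  | nop
  | setNat (a : ℕ) (i e : NatExp)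
  | setReal (a : ℕ) (i : NatExp) (e : RealExp)
  | seq (P Q : Program)
  | branch (b : Test) (P Q : Program)
  | loop (b : Test) (P : Program)

/-- The state after `a[i] := k` for an array of natural numbers. -/
def State.setNat (s : State) (a i k : ℕ) : State :=
  { s with nat := Function.update s.nat a (Function.update (s.nat a) i k) }

/-- The state after `a[i] := x` for an array of real numbers. -/
def State.setReal (s : State) (a i : ℕ) (x : ℝ) : State :=
  { s with real := Function.update s.real a (Function.update (s.real a) i x) }

/-- `Exec P s s' t`: started in `s`, the program `P` halts in `s'` after `t` steps. -/
inductive Exec : Program → State → State → ℕ → Prop where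
  | nop (s : State) : Exec .nop s s 1
  | setNat (s : State) (a : ℕ) (i e : NatExp) :
      Exec (.setNat a i e) s (s.setNat a (i.eval s) (e.eval s)) (i.time + e.time + 1)
  | setReal (s : State) (a : ℕ) (i : NatExp) (e : RealExp) :
      Exec (.setReal a i e) s (s.setReal a (i.eval s) (e.eval s)) (i.time + e.time + 1)
  | seq {P Q : Program} {s s' s'' : State} {t t' : ℕ} :
      Exec P s s' t → Exec Q s' s'' t' → Exec (.seq P Q) s s'' (t + t')
  | branch_true {b : Test} {P Q : Program} {s s' : State} {t : ℕ} :
      b.Holds s → Exec P s s' t → Exec (.branch b P Q) s s' (b.time + 1 + t)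
  | branch_false {b : Test} {P Q : Program} {s s' : State} {t : ℕ} :
      ¬ b.Holds s → Exec Q s s' t → Exec (.branch b P Q) s s' (b.time + 1 + t)
  | loop_false {b : Test} {P : Program} {s : State} :
      ¬ b.Holds s → Exec (.loop b P) s s (b.time + 1)
  | loop_true {b : Test} {P : Program} {s s' s'' : State} {t t' : ℕ} :
      b.Holds s → Exec P s s' t → Exec (.loop b P) s' s'' t' →
        Exec (.loop b P) s s'' (b.time + 1 + t + t')

/-! ### Input and output -/

/-- Array `0` of natural numbers holds `r, n, g`, array `1` holds `γ_1, …, γ_g` in the cells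
`1, …, g`, array `0` of real numbers holds the weights in the cells `0, …, n - 1`; all other cells
are `0`. -/
def Problem.input (I : Problem) : State where
  nat a i :=
    if a = 0 then (if i = 0 then I.r else if i = 1 then I.n else if i = 2 then I.g else 0)
    else if a = 1 then (if 1 ≤ i ∧ i ≤ I.g then I.γ i else 0)
    else 0
  real a j := if a = 0 then (if h : j < I.n then I.p ⟨j, h⟩ else 0) else 0

/-- The output is read as follows. Cell `0` of array `2` of natural numbers tells whether any tree
satisfies the constraints. If so, cells `1, …, g` of array `3` are the leaf sequence of an optimal
tree (the numbers of leaves on the levels `γ_1, …, γ_g`), which is also the leaf sequence of a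
corresponding optimal GMR tree, and cell `0` of array `1` of real numbers is the optimal cost. -/
def Problem.Solved (I : Problem) (s : State) : Prop :=
  ((¬ ∃ T, I.Feasible T) ∧ s.nat 2 0 = 0) ∨
  (s.nat 2 0 = 1 ∧ ∃ T T' : LabelledTree I.n,
    I.IsOptimalTree T ∧ I.IsOptimalGMR T' ∧ I.Corresponds T T' ∧
    (∀ i, 1 ≤ i → i ≤ I.g → s.nat 3 i = leafCount T (I.γ i) ∧ s.nat 3 i = leafCount T' i) ∧
    s.real 1 0 = pathCost I.p T)

end ReservedLength

end

noncomputable section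

namespace ReservedLength

/-! ### Fixed-length base-`r` expansions -/

/-- The last `k` base-`r` digits of `x`, most significant digit first. -/
def digs (r : ℕ) : ℕ → ℕ → List ℕ
  | 0, _ => []
  | k + 1, x => digs r k (x / r) ++ [x % r]

@[simp] lemma length_digs (r k x : ℕ) : (digs r k x).length = k := by
  induction k generalizing x with
  | zero => rfl
  | succ k ih => simp [digs, ih]

lemma lt_of_mem_digs {r : ℕ} (hr : 0 < r) {k x a : ℕ} (h : a ∈ digs r k x) : a < r := by
  induction k generalizing x with
  | zero => simp [digs] at h
  | succ k ih =>
    simp only [digs, List.mem_append, List.mem_singleton] at h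
    rcases h with h | rfl
    · exact ih h
    · exact Nat.mod_lt _ hr

lemma digs_add (r m k x : ℕ) : digs r (m + k) x = digs r m (x / r ^ k) ++ digs r k x := by
  induction k generalizing x with
  | zero => simp [digs]
  | succ k ih =>
    rw [← add_assoc, digs, ih, digs, Nat.div_div_eq_div_mul, pow_succ', List.append_assoc]

lemma digs_injOn {r : ℕ} {k x y : ℕ} (hx : x < r ^ k) (hy : y < r ^ k)
    (h : digs r k x = digs r k y) : x = y := by
  induction k generalizing x y with
  | zero => simp at hx hy; omega
  | succ k ih =>
    simp only [digs] at h
    obtain ⟨h1, h2⟩ := List.append_inj' h rfl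
    have hm : x % r = y % r := by simpa using h2
    have hd := ih (Nat.div_lt_of_lt_mul (by rwa [pow_succ'] at hx))
      (Nat.div_lt_of_lt_mul (by rwa [pow_succ'] at hy)) h1
    rw [← Nat.div_add_mod x r, ← Nat.div_add_mod y r, hm, hd]

lemma exists_digs_eq {r : ℕ} (w : List ℕ) (hw : ∀ a ∈ w, a < r) :
    ∃ x < r ^ w.length, digs r w.length x = w := by
  induction w using List.reverseRecOn with
  | nil => exact ⟨0, by simp, rfl⟩
  | append_singleton w a ih =>
    obtain ⟨x, hx, hxw⟩ := ih fun b hb => hw b (by simp [hb])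
    have ha : a < r := hw a (by simp)
    refine ⟨r * x + a, ?_, ?_⟩
    · simp only [List.length_append, List.length_singleton, pow_succ']
      calc r * x + a < r * (x + 1) := by rw [mul_add]; omega
        _ ≤ _ := Nat.mul_le_mul_left _ hx
    · have h1 : (r * x + a) / r = x := by
        rw [Nat.mul_add_div (by omega), Nat.div_eq_of_lt ha, add_zero]
      have h2 : (r * x + a) % r = a := by rw [Nat.mul_add_mod, Nat.mod_eq_of_lt ha]
      simp [digs, h1, h2, hxw]

lemma eq_div_of_digs_prefix {r m k x y : ℕ} (hx : x < r ^ m) (hy : y < r ^ (m + k))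
    (h : digs r m x <+: digs r (m + k) y) : x = y / r ^ k := by
  rw [digs_add] at h
  have h' : digs r m x = digs r m (y / r ^ k) :=
    (List.prefix_of_prefix_length_le h (List.prefix_append _ _) (by simp)).eq_of_length (by simp)
  refine digs_injOn hx (Nat.div_lt_of_lt_mul ?_) h'
  rwa [pow_add, mul_comm] at hy

/-! ### Words whose letters are bounded position by position -/

/-- The `i`-th letter of `v` is smaller than `R i`. -/
def Valid : (ℕ → ℕ) → List ℕ → Prop
  | _, [] => True
  | R, a :: v => a < R 0 ∧ Valid (fun i => R (i + 1)) v

lemma valid_append {R : ℕ → ℕ} {u v : List ℕ} :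
    Valid R (u ++ v) ↔ Valid R u ∧ Valid (fun i => R (i + u.length)) v := by
  induction u generalizing R with
  | nil => simp [Valid]
  | cons a u ih => simp [Valid, ih, and_assoc, add_assoc]

lemma Valid.of_prefix {R : ℕ → ℕ} {u v : List ℕ} (hv : Valid R v) (h : u <+: v) : Valid R u := by
  obtain ⟨t, rfl⟩ := h
  exact (valid_append.1 hv).1

lemma valid_const {r : ℕ} {v : List ℕ} : Valid (fun _ => r) v ↔ ∀ a ∈ v, a < r := by
  induction v with
  | nil => simp [Valid]
  | cons a v ih => simp [Valid, ih]

/-- Replace the `i`-th letter of a word by its base-`r` expansion of length `d i`. -/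
def enc (r : ℕ) : (ℕ → ℕ) → List ℕ → List ℕ
  | _, [] => []
  | d, a :: v => digs r (d 0) a ++ enc r (fun i => d (i + 1)) v

lemma enc_append (r : ℕ) (d : ℕ → ℕ) (u v : List ℕ) :
    enc r d (u ++ v) = enc r d u ++ enc r (fun i => d (i + u.length)) v := by
  induction u generalizing d with
  | nil => simp [enc]
  | cons a u ih => simp [enc, ih, add_assoc]

lemma length_enc (r : ℕ) (d : ℕ → ℕ) (v : List ℕ) :
    (enc r d v).length = ∑ i ∈ Finset.range v.length, d i := by
  induction v generalizing d with
  | nil => simp [enc]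
  | cons a v ih => simp [enc, ih, Finset.sum_range_succ', add_comm]

lemma enc_prefix {r : ℕ} {d : ℕ → ℕ} {u v : List ℕ} (h : u <+: v) :
    enc r d u <+: enc r d v := by
  obtain ⟨t, rfl⟩ := h
  rw [enc_append]
  exact List.prefix_append _ _

lemma lt_of_mem_enc {r : ℕ} (hr : 0 < r) {d : ℕ → ℕ} {v : List ℕ} {a : ℕ}
    (h : a ∈ enc r d v) : a < r := by
  induction v generalizing d with
  | nil => simp [enc] at h
  | cons b v ih =>
    simp only [enc, List.mem_append] at h
    rcases h with h | h
    · exact lt_of_mem_digs hr h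
    · exact ih h

lemma prefix_of_enc_prefix {r : ℕ} {d R : ℕ → ℕ} (hR : ∀ i a, a < R i → 0 < d i ∧ a < r ^ d i)
    {u v : List ℕ} (hu : Valid R u) (hv : Valid R v) (h : enc r d u <+: enc r d v) : u <+: v := by
  induction u generalizing d R v with
  | nil => exact List.nil_prefix
  | cons a u ih =>
    obtain ⟨hd, ha⟩ := hR 0 a hu.1
    cases v with
    | nil =>
      have := h.length_le
      simp [enc] at this
      omega
    | cons b v =>
      have hb := (hR 0 b hv.1).2
      simp only [enc] at h
      have h1 : digs r (d 0) a <+: digs r (d 0) b ++ enc r (fun i => d (i + 1)) v :=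
        (List.prefix_append _ _).trans h
      have h2 : digs r (d 0) a = digs r (d 0) b :=
        (List.prefix_of_prefix_length_le h1 (List.prefix_append _ _) (by simp)).eq_of_length
          (by simp)
      obtain rfl := digs_injOn ha hb h2
      rw [List.prefix_append_right_inj] at h
      rw [List.cons_prefix_cons]
      exact ⟨rfl, ih (fun i => hR (i + 1)) hu.2 hv.2 h⟩

lemma exists_enc_eq {r : ℕ} {d R : ℕ → ℕ} (k : ℕ) (hR : ∀ i < k, R i = r ^ d i) (w : List ℕ)
    (hw : ∀ a ∈ w, a < r) (hk : w.length = ∑ i ∈ Finset.range k, d i) :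
    ∃ v, v.length = k ∧ Valid R v ∧ enc r d v = w := by
  induction k generalizing d R w with
  | zero =>
    refine ⟨[], rfl, trivial, ?_⟩
    simp at hk
    simp [enc, hk]
  | succ k ih =>
    rw [Finset.sum_range_succ'] at hk
    obtain ⟨v, hvl, hv, hvw⟩ := ih (d := fun i => d (i + 1)) (R := fun i => R (i + 1))
      (fun i hi => hR (i + 1) (by omega)) (w.drop (d 0))
      (fun a ha => hw a (List.mem_of_mem_drop ha)) (by simp; omega)
    obtain ⟨x, hx, hxw⟩ := exists_digs_eq (w.take (d 0)) fun a ha => hw a (List.mem_of_mem_take ha)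
    have hl : (w.take (d 0)).length = d 0 := by simp; omega
    rw [hl] at hx hxw
    refine ⟨x :: v, by simp [hvl], ⟨?_, hv⟩, ?_⟩
    · rw [hR 0 (by omega)]; exact hx
    · rw [enc, hvw, hxw, List.take_append_drop]

/-! ### Trees and prefix-free families of words -/

namespace LabelledTree

variable {n : ℕ}

lemma mem_of_prefix (T : LabelledTree n) {u v : List ℕ} (hv : v ∈ T.nodes) (h : u <+: v) :
    u ∈ T.nodes := by
  obtain ⟨t, rfl⟩ := h
  induction t using List.reverseRecOn with
  | nil => simpa using hv
  | append_singleton t a ih => exact ih (T.parent_mem _ a (by simpa using hv))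

lemma leaf_mem (T : LabelledTree n) (j : Fin n) : T.leaf j ∈ T.nodes :=
  ((T.mem_range_leaf _).1 ⟨j, rfl⟩).1

lemma exists_prefix_leaf (T : LabelledTree n) {v : List ℕ} (hv : v ∈ T.nodes) :
    ∃ j, v <+: T.leaf j := by
  obtain ⟨w, hw, hmax⟩ := (T.nodes.filter (v <+: ·)).exists_max_image List.length
    ⟨v, by simp [hv]⟩
  simp only [Finset.mem_filter] at hw hmax
  obtain ⟨j, hj⟩ := (T.mem_range_leaf w).2 ⟨hw.1, fun a ha => by
    have := hmax _ ⟨ha, hw.2.trans (List.prefix_append _ _)⟩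
    simp at this⟩
  exact ⟨j, hj ▸ hw.2⟩

lemma mem_nodes_iff (T : LabelledTree n) {v : List ℕ} : v ∈ T.nodes ↔ ∃ j, v <+: T.leaf j :=
  ⟨T.exists_prefix_leaf, fun ⟨j, hj⟩ => T.mem_of_prefix (T.leaf_mem j) hj⟩

lemma eq_of_leaf_prefix (T : LabelledTree n) {i j : Fin n} (h : T.leaf i <+: T.leaf j) :
    i = j := by
  obtain ⟨t, ht⟩ := h
  cases t with
  | nil => exact T.leaf_injective (by simpa using ht)
  | cons a t =>
    refine absurd (T.mem_of_prefix (T.leaf_mem j) ⟨t, ?_⟩)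
      (((T.mem_range_leaf _).1 ⟨i, rfl⟩).2 a)
    simpa using ht

/-- The tree whose leaves are the words of a prefix-free family. -/
def ofPrefixFree (hn : 0 < n) (w : Fin n → List ℕ) (hw : ∀ i j, w i <+: w j → i = j) :
    LabelledTree n where
  nodes := Finset.univ.biUnion fun j => (w j).inits.toFinset
  root_mem := by simpa using ⟨⟨0, hn⟩⟩
  parent_mem v a h := by
    simp only [Finset.mem_biUnion, Finset.mem_univ, List.mem_toFinset, List.mem_inits,
      true_and] at h ⊢
    obtain ⟨j, hj⟩ := h
    exact ⟨j, (List.prefix_append _ _).trans hj⟩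
  leaf := w
  leaf_injective i j h := hw i j (h ▸ List.prefix_rfl)
  mem_range_leaf v := by
    simp only [Finset.mem_biUnion, Finset.mem_univ, List.mem_toFinset, List.mem_inits,
      true_and, Set.mem_range, not_exists]
    constructor
    · rintro ⟨j, rfl⟩
      refine ⟨⟨j, List.prefix_rfl⟩, fun a i hi => ?_⟩
      obtain rfl := hw j i ((List.prefix_append _ _).trans hi)
      have := hi.length_le
      simp at this
    · rintro ⟨⟨j, t, ht⟩, h⟩
      cases t with
      | nil => exact ⟨j, by simpa using ht.symm⟩
      | cons a t => exact absurd ⟨t, by simpa using ht⟩ (h a j)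

lemma isGMR_iff (T : LabelledTree n) {R : ℕ → ℕ} :
    IsGMR R T ↔ ∀ j, Valid R (T.leaf j) := by
  constructor
  · intro h j
    suffices H : ∀ v, v <+: T.leaf j → Valid R v from H _ List.prefix_rfl
    intro v
    induction v using List.reverseRecOn with
    | nil => exact fun _ => trivial
    | append_singleton v a ih =>
      intro hv
      refine valid_append.2 ⟨ih ((List.prefix_append _ _).trans hv), ?_, trivial⟩
      simpa using h v a (T.mem_nodes_iff.2 ⟨j, hv⟩)
  · intro h v a hva
    obtain ⟨j, hj⟩ := T.exists_prefix_leaf hva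
    simpa using (valid_append.1 ((h j).of_prefix hj)).2.1

lemma isRary_iff (T : LabelledTree n) {r : ℕ} :
    IsRary r T ↔ ∀ j, ∀ a ∈ T.leaf j, a < r :=
  (T.isGMR_iff (R := fun _ => r)).trans (forall_congr' fun _ => valid_const)

end LabelledTree

/-! ### The Kraft inequality -/

lemma kraft_le {n r L : ℕ} (T : LabelledTree n) (hT : IsRary r T)
    (hL : ∀ j, (T.leaf j).length ≤ L) : ∑ j, r ^ (L - (T.leaf j).length) ≤ r ^ L := by
  classical
  rw [T.isRary_iff] at hT
  let A : Fin n → Finset ℕ := fun j => (Finset.range (r ^ L)).filter (T.leaf j <+: digs r L ·)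
  have hA : ∀ j, r ^ (L - (T.leaf j).length) ≤ (A j).card := by
    intro j
    obtain ⟨y, hy, hyw⟩ := exists_digs_eq (T.leaf j) (hT j)
    set m := (T.leaf j).length
    obtain ⟨k, rfl⟩ := Nat.exists_eq_add_of_le (hL j)
    rw [Nat.add_sub_cancel_left]
    have : ((Finset.range (r ^ k)).image (fun z => y * r ^ k + z)).card = r ^ k := by
      rw [Finset.card_image_of_injective _ (fun a b h => by simpa using h), Finset.card_range]
    rw [← this]
    refine Finset.card_le_card fun x hx => ?_
    simp only [Finset.mem_image, Finset.mem_range] at hx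
    obtain ⟨z, hz, rfl⟩ := hx
    simp only [A, Finset.mem_filter, Finset.mem_range]
    constructor
    · calc y * r ^ k + z < (y + 1) * r ^ k := by rw [add_mul]; omega
        _ ≤ r ^ m * r ^ k := Nat.mul_le_mul_right _ hy
        _ = _ := (pow_add _ _ _).symm
    · have : (y * r ^ k + z) / r ^ k = y := by
        rw [mul_comm, Nat.mul_add_div (by omega), Nat.div_eq_of_lt hz, add_zero]
      rw [digs_add, this, hyw]
      exact List.prefix_append _ _
  calc ∑ j, r ^ (L - (T.leaf j).length) ≤ ∑ j, (A j).card := Finset.sum_le_sum fun j _ => hA j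
    _ = (Finset.univ.biUnion A).card := by
      refine (Finset.card_biUnion fun i _ j _ hij => ?_).symm
      refine Finset.disjoint_left.2 fun x hi hj => hij ?_
      simp only [A, Finset.mem_filter] at hi hj
      rcases List.prefix_or_prefix_of_prefix hi.2 hj.2 with h | h
      · exact T.eq_of_leaf_prefix h
      · exact (T.eq_of_leaf_prefix h).symm
    _ ≤ (Finset.range (r ^ L)).card := Finset.card_le_card (by
      intro x hx
      simp only [Finset.mem_biUnion, A, Finset.mem_filter] at hx
      exact hx.choose_spec.2.1)
    _ = r ^ L := Finset.card_range _

/-- The numerators of the partial Kraft sums, as multiples of `r ^ (- l j)`. -/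
def kraftNumerator {n : ℕ} (r : ℕ) (l : Fin n → ℕ) (j : Fin n) : ℕ :=
  ∑ k ∈ Finset.univ.filter (· < j), r ^ (l j - l k)

lemma succ_kraftNumerator_mul_le {n r : ℕ} {l : Fin n → ℕ} (hl : Monotone l) {i j : Fin n}
    (h : i < j) : (kraftNumerator r l i + 1) * r ^ (l j - l i) ≤ kraftNumerator r l j := by
  have hij := hl h.le
  have h1 : (kraftNumerator r l i + 1) * r ^ (l j - l i) =
      ∑ k ∈ insert i (Finset.univ.filter (· < i)), r ^ (l j - l k) := by
    rw [Finset.sum_insert (by simp), add_mul, one_mul, add_comm, kraftNumerator, Finset.sum_mul]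
    congr 1
    refine Finset.sum_congr rfl fun k hk => ?_
    have := hl (Finset.mem_filter.1 hk).2.le
    rw [← pow_add]
    congr 1
    omega
  rw [h1]
  refine Finset.sum_le_sum_of_subset fun k hk => ?_
  simp only [Finset.mem_insert, Finset.mem_filter, Finset.mem_univ, true_and] at hk ⊢
  rcases hk with rfl | hk
  · exact h
  · exact hk.trans h

lemma kraftNumerator_lt {n r L : ℕ} {l : Fin n → ℕ} (hr : 0 < r) (hl : Monotone l)
    (hL : ∀ j, l j ≤ L) (hk : ∑ j, r ^ (L - l j) ≤ r ^ L) (j : Fin n) :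
    kraftNumerator r l j < r ^ l j := by
  have h1 : (kraftNumerator r l j + 1) * r ^ (L - l j) ≤ r ^ l j * r ^ (L - l j) := by
    have hj := hL j
    rw [← pow_add, Nat.add_sub_cancel' (hL j)]
    refine le_trans ?_ hk
    have h1 : (kraftNumerator r l j + 1) * r ^ (L - l j) =
        ∑ k ∈ insert j (Finset.univ.filter (· < j)), r ^ (L - l k) := by
      rw [Finset.sum_insert (by simp), add_mul, one_mul, add_comm, kraftNumerator, Finset.sum_mul]
      congr 1
      refine Finset.sum_congr rfl fun k hk => ?_
      have := hl (Finset.mem_filter.1 hk).2.le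
      rw [← pow_add]
      congr 1
      omega
    rw [h1]
    exact Finset.sum_le_sum_of_subset (Finset.subset_univ _)
  exact Nat.le_of_mul_le_mul_right h1 (pow_pos hr _)

lemma exists_tree_of_kraft {n r L : ℕ} {l : Fin n → ℕ} (hn : 0 < n) (hr : 0 < r)
    (hl : Monotone l) (hL : ∀ j, l j ≤ L) (hk : ∑ j, r ^ (L - l j) ≤ r ^ L) :
    ∃ T : LabelledTree n, IsRary r T ∧ ∀ j, (T.leaf j).length = l j := by
  have hlt := kraftNumerator_lt hr hl hL hk
  refine ⟨LabelledTree.ofPrefixFree hn (fun j => digs r (l j) (kraftNumerator r l j)) ?_,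
    (LabelledTree.isRary_iff _).2 fun j a ha => lt_of_mem_digs hr ha, fun j => length_digs _ _ _⟩
  intro i j h
  have hij : l i ≤ l j := by simpa using h.length_le
  obtain ⟨k, hk⟩ := Nat.exists_eq_add_of_le hij
  have hi := hlt i
  have hj := hlt j
  rw [hk] at h hj
  have key := eq_div_of_digs_prefix hi hj h
  rcases lt_trichotomy i j with hlt | heq | hgt
  · have := succ_kraftNumerator_mul_le (r := r) hl hlt
    rw [hk, Nat.add_sub_cancel_left, ← Nat.le_div_iff_mul_le (pow_pos hr _)] at this
    omega
  · exact heq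
  · have h1 := succ_kraftNumerator_mul_le (r := r) hl hgt
    have h2 := hl hgt.le
    have h3 : k = 0 := by omega
    subst h3
    have h4 : l i - l j = 0 := by omega
    simp [h4] at h1 key
    omega

/-! ### The correspondence -/

namespace Problem

variable (I : Problem)

lemma γ_strictMono {i j : ℕ} (hij : i < j) (hj : j ≤ I.g) : I.γ i < I.γ j := by
  induction j, hij using Nat.le_induction with
  | base => exact I.γ_lt i (by omega)
  | succ j h ih => exact (ih (by omega)).trans (I.γ_lt j (by omega))

lemma γ_mono {i j : ℕ} (hij : i ≤ j) (hj : j ≤ I.g) : I.γ i ≤ I.γ j := by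
  rcases hij.eq_or_lt with rfl | h
  · rfl
  · exact (I.γ_strictMono h hj).le

lemma γ_inj {i j : ℕ} (hi : i ≤ I.g) (hj : j ≤ I.g) : I.γ i = I.γ j ↔ i = j := by
  refine ⟨fun h => ?_, fun h => h ▸ rfl⟩
  rcases lt_trichotomy i j with h' | h' | h'
  · exact absurd h (I.γ_strictMono h' hj).ne
  · exact h'
  · exact absurd h.symm (I.γ_strictMono h' hi).ne

/-- The number of `r`-ary levels bridged by the edges from level `i` to level `i + 1`. -/
def gap (i : ℕ) : ℕ := I.γ (i + 1) - I.γ i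

lemma sum_gap {k : ℕ} (hk : k ≤ I.g) : ∑ i ∈ Finset.range k, I.gap i = I.γ k := by
  induction k with
  | zero => simp [I.γ_zero]
  | succ k ih =>
    have := I.γ_lt k (by omega)
    rw [Finset.sum_range_succ, ih (by omega), gap]
    omega

lemma lt_arity {i a : ℕ} (h : a < I.arity i) : i < I.g ∧ 0 < I.gap i ∧ a < I.r ^ I.gap i := by
  unfold arity at h
  split_ifs at h with hi
  · have := I.γ_lt i hi
    exact ⟨hi, by unfold gap; omega, h⟩
  · omega

lemma length_le_of_valid {v : List ℕ} (h : Valid I.arity v) : v.length ≤ I.g := by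
  induction v using List.reverseRecOn with
  | nil => simp
  | append_singleton v a ih =>
    have := (valid_append.1 h).2.1
    simpa using (I.lt_arity this).1

/-- Expand every letter of a GMR word into the corresponding `r`-ary word. -/
def expand (v : List ℕ) : List ℕ := enc I.r I.gap v

lemma length_expand {v : List ℕ} (hv : v.length ≤ I.g) : (I.expand v).length = I.γ v.length := by
  rw [expand, length_enc, I.sum_gap hv]

lemma expand_prefix_iff {u v : List ℕ} (hu : Valid I.arity u) (hv : Valid I.arity v) :
    I.expand u <+: I.expand v ↔ u <+: v :=
  ⟨prefix_of_enc_prefix (fun _ _ h => (I.lt_arity h).2) hu hv, enc_prefix⟩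

lemma corresponds_of_leaf {T T' : LabelledTree I.n} (hT' : IsGMR I.arity T')
    (h : ∀ j, I.expand (T'.leaf j) = T.leaf j) : I.Corresponds T T' := by
  have hval : ∀ v ∈ T'.nodes, Valid I.arity v := fun v hv => by
    obtain ⟨j, hj⟩ := T'.exists_prefix_leaf hv
    exact (T'.isGMR_iff.1 hT' j).of_prefix hj
  have hlen : ∀ v ∈ T'.nodes, v.length ≤ I.g := fun v hv => I.length_le_of_valid (hval v hv)
  refine ⟨I.expand, ⟨?_, ?_, ?_⟩, fun v hv => ⟨hlen v hv, I.length_expand (hlen v hv)⟩, ?_, h⟩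
  · intro v hv
    obtain ⟨j, hj⟩ := T'.exists_prefix_leaf hv
    exact ⟨T.mem_nodes_iff.2 ⟨j, h j ▸ enc_prefix hj⟩, v.length, hlen v hv,
      I.length_expand (hlen v hv)⟩
  · intro u hu v hv huv
    have h1 := (I.expand_prefix_iff (hval u hu) (hval v hv)).1 (huv ▸ List.prefix_rfl)
    have h2 := (I.expand_prefix_iff (hval v hv) (hval u hu)).1 (huv ▸ List.prefix_rfl)
    exact h1.eq_of_length (le_antisymm h1.length_le h2.length_le)
  · rintro w ⟨hw, i, hi, hwi⟩
    obtain ⟨j, hj⟩ := T.exists_prefix_leaf hw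
    rw [← h j] at hj
    have hl := hlen _ (T'.leaf_mem j)
    have hij : i ≤ (T'.leaf j).length := by
      by_contra! hc
      have h1 := I.γ_strictMono hc hi
      have h2 := hj.length_le
      rw [I.length_expand hl] at h2
      omega
    have htl : ((T'.leaf j).take i).length = i := by simp [hij]
    refine ⟨(T'.leaf j).take i, T'.mem_nodes_iff.2 ⟨j, List.take_prefix _ _⟩, ?_⟩
    have hp : I.expand ((T'.leaf j).take i) <+: I.expand (T'.leaf j) :=
      enc_prefix (List.take_prefix _ _)
    have he : (I.expand ((T'.leaf j).take i)).length = w.length := by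
      rw [I.length_expand (by omega), htl, hwi]
    exact (List.prefix_of_prefix_length_le hp hj he.le).eq_of_length he
  · intro u hu v hv huv
    rw [I.expand_prefix_iff (hval u hu) (hval v hv)]
    constructor
    · rintro ⟨a, rfl⟩
      exact List.prefix_append _ _
    · rintro ⟨t, rfl⟩
      rw [List.length_append, Nat.add_left_cancel_iff, List.length_eq_one_iff] at huv
      obtain ⟨a, rfl⟩ := huv
      exact ⟨a, rfl⟩

lemma exists_gmr {T : LabelledTree I.n} (hT : I.Feasible T) :
    ∃ T', IsGMR I.arity T' ∧ I.Corresponds T T' := by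
  have H : ∀ j, ∃ v, Valid I.arity v ∧ I.expand v = T.leaf j := by
    intro j
    obtain ⟨i, _, hi, hij⟩ := hT.2 ⟨j, rfl⟩
    obtain ⟨v, _, hv, hvw⟩ := exists_enc_eq (r := I.r) (d := I.gap) (R := I.arity) i
      (fun k hk => by rw [arity, if_pos (by omega), gap]) (T.leaf j) (T.isRary_iff.1 hT.1 j)
      (by rw [I.sum_gap hi]; exact hij)
    exact ⟨v, hv, hvw⟩
  choose w hw hwT using H
  have hn := I.two_le_n
  let T' : LabelledTree I.n := .ofPrefixFree (by omega) w fun i j h =>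
    T.eq_of_leaf_prefix (by rw [← hwT, ← hwT]; exact enc_prefix h)
  have hT' : IsGMR I.arity T' := T'.isGMR_iff.2 hw
  exact ⟨T', hT', I.corresponds_of_leaf hT' hwT⟩

lemma exists_feasible {T' : LabelledTree I.n} (hT' : IsGMR I.arity T') :
    ∃ T, I.Feasible T ∧ I.Corresponds T T' := by
  have hn := I.two_le_n
  have hr := I.two_le_r
  have hval := T'.isGMR_iff.1 hT'
  let T : LabelledTree I.n := .ofPrefixFree (by omega) (fun j => I.expand (T'.leaf j))
    fun i j h => T'.eq_of_leaf_prefix ((I.expand_prefix_iff (hval i) (hval j)).1 h)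
  refine ⟨T, ⟨T.isRary_iff.2 fun j a ha => lt_of_mem_enc (by omega) ha, ?_⟩,
    I.corresponds_of_leaf hT' fun j => rfl⟩
  rintro _ ⟨j, rfl⟩
  have hl := I.length_le_of_valid (hval j)
  refine ⟨(T'.leaf j).length, ?_, hl, I.length_expand hl⟩
  by_contra! hc
  have h0 : T'.leaf j = [] := by simpa using hc
  have h1 : ∀ i, j = i := fun i => T'.eq_of_leaf_prefix (h0 ▸ List.nil_prefix)
  have h2 := (h1 ⟨0, by omega⟩).symm.trans (h1 ⟨1, by omega⟩)
  simp at h2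

variable {I}

lemma Corresponds.length_leaf {T T' : LabelledTree I.n} (h : I.Corresponds T T') (j : Fin I.n) :
    (T'.leaf j).length ≤ I.g ∧ (T.leaf j).length = I.γ (T'.leaf j).length := by
  obtain ⟨φ, _, h1, _, h2⟩ := h
  rw [← h2 j]
  exact h1 _ (T'.leaf_mem j)

lemma Corresponds.leafCount_eq {T T' : LabelledTree I.n} (h : I.Corresponds T T') {i : ℕ}
    (hi : i ≤ I.g) : leafCount T (I.γ i) = leafCount T' i := by
  unfold leafCount
  congr 1
  ext j
  have := h.length_leaf j
  simp [this.2, I.γ_inj this.1 hi]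

lemma Corresponds.cost_eq {T T' : LabelledTree I.n} (h : I.Corresponds T T') :
    pathCost I.p T = gmrCost I.edgeLength I.p T' := by
  unfold pathCost gmrCost depth edgeLength
  refine Finset.sum_congr rfl fun j _ => ?_
  rw [Finset.sum_range_sub (fun i => (I.γ i : ℝ)), I.γ_zero, (h.length_leaf j).2]
  simp

lemma Corresponds.isOptimal_iff {T T' : LabelledTree I.n} (hT : I.Feasible T)
    (hT' : IsGMR I.arity T') (h : I.Corresponds T T') : I.IsOptimalTree T ↔ I.IsOptimalGMR T' := by
  constructor
  · rintro ⟨_, H⟩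
    refine ⟨hT', fun S hS => ?_⟩
    obtain ⟨S', hS', hc⟩ := I.exists_feasible hS
    rw [← h.cost_eq, ← hc.cost_eq]
    exact H _ hS'
  · rintro ⟨_, H⟩
    refine ⟨hT, fun S hS => ?_⟩
    obtain ⟨S', hS', hc⟩ := I.exists_gmr hS
    rw [h.cost_eq, hc.cost_eq]
    exact H _ hS'

end Problem

/-! ### The dynamic program

Levels are counted upwards from the lowest permitted level `γ_g`, and leaves from the last (lightest)
one. -/

namespace Problem

variable (I : Problem)

/-- The height of level `γ_{g-k}` above level `γ_g`. -/
def height (k : ℕ) : ℕ := I.γ I.g - I.γ (I.g - k)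

/-- The length of the edges that lead down from level `γ_{g-k}`. -/
def stepLen (k : ℕ) : ℕ := I.input.nat 1 (I.g - k + 1) - I.input.nat 1 (I.g - k)

/-- The weight of the `y`-th leaf from the end. -/
def weight (y : ℕ) : ℝ := I.input.real 0 (I.n - (y + 1))

/-- The total weight of the last `q` leaves. -/
def tailSum (q : ℕ) : ℝ := ∑ y ∈ Finset.range q, I.weight y

/-- A number exceeding the cost of every feasible tree. -/
def penalty : ℝ := I.γ I.g * I.tailSum I.n + 1

/-- The number of nodes below `b` nodes on level `γ_{g-k}` on the next permitted level, capped at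
the number of leaves. -/
def children (k b : ℕ) : ℕ := min (b * I.r ^ I.stepLen k) I.n

/-- The minimum cost of placing the last `q` leaves on or below `b` nodes of level `γ_{g-k}`, with
levels measured from there; at least `penalty` if this is impossible. -/
def value : ℕ → ℕ → ℕ → ℝ
  | 0, q, b => if q ≤ b then 0 else I.penalty
  | _ + 1, 0, _ => 0
  | k + 1, q + 1, b =>
    if 1 ≤ b ∧ value (k + 1) q (b - 1) ≤
        I.stepLen (k + 1) * I.tailSum (q + 1) + value k (q + 1) (I.children (k + 1) b)
    then value (k + 1) q (b - 1)
    else I.stepLen (k + 1) * I.tailSum (q + 1) + value k (q + 1) (I.children (k + 1) b)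

lemma input_nat_one {i : ℕ} (hi : i ≤ I.g) : I.input.nat 1 i = I.γ i := by
  rcases Nat.eq_zero_or_pos i with rfl | h
  · simp [input, I.γ_zero]
  · simp [input, hi, Nat.one_le_iff_ne_zero.2 h.ne']

@[simp] lemma height_zero : I.height 0 = 0 := by simp [height]

@[simp] lemma height_g : I.height I.g = I.γ I.g := by simp [height, I.γ_zero]

lemma height_succ {k : ℕ} (hk : k < I.g) : I.height (k + 1) = I.height k + I.stepLen (k + 1) := by
  have h : I.g - (k + 1) + 1 = I.g - k := by omega
  rw [stepLen, h, I.input_nat_one (by omega), I.input_nat_one (by omega), height, height]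
  have h1 := I.γ_mono (i := I.g - (k + 1)) (j := I.g - k) (by omega) (by omega)
  have h2 := I.γ_mono (i := I.g - k) (j := I.g) (by omega) (by omega)
  omega

lemma height_mono {k k' : ℕ} (h : k ≤ k') : I.height k ≤ I.height k' := by
  have := I.γ_mono (i := I.g - k') (j := I.g - k) (by omega) (by omega)
  unfold height
  omega

lemma weight_nonneg (y : ℕ) : 0 ≤ I.weight y := by
  simp only [weight, input, if_true]
  split_ifs
  · exact I.p_nonneg _
  · rfl

lemma weight_rev (j : Fin I.n) : I.weight j.rev = I.p j := by
  have h : I.n - ((j.rev : ℕ) + 1) = j := by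
    rw [Fin.val_rev]; omega
  simp only [weight, input, if_true, h, Fin.is_lt, dif_pos, Fin.eta]

lemma tailSum_nonneg (q : ℕ) : 0 ≤ I.tailSum q :=
  Finset.sum_nonneg fun _ _ => I.weight_nonneg _

lemma tailSum_succ (q : ℕ) : I.tailSum (q + 1) = I.tailSum q + I.weight q :=
  Finset.sum_range_succ _ _

@[simp] lemma value_zero_right (k b : ℕ) : I.value k 0 b = 0 := by
  cases k <;> simp [value]

lemma value_le_left (k q b : ℕ) : I.value (k + 1) (q + 1) (b + 1) ≤ I.value (k + 1) q b := by
  rw [value]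
  split_ifs with h
  · simp
  · simp only [Nat.add_sub_cancel, not_and, not_le] at h
    exact (h (by omega)).le

lemma value_le_right (k q b : ℕ) : I.value (k + 1) (q + 1) b ≤
    I.stepLen (k + 1) * I.tailSum (q + 1) + I.value k (q + 1) (I.children (k + 1) b) := by
  rw [value]
  split_ifs with h
  · exact h.2
  · rfl

lemma value_le {k : ℕ} (hk : k ≤ I.g) {q : ℕ} (hq : q ≤ I.n) {b : ℕ} {h : ℕ → ℕ}
    (hle : ∀ y < q, h y ≤ k) (hmono : ∀ y z, y ≤ z → z < q → h y ≤ h z)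
    (hkraft : ∑ y ∈ Finset.range q, I.r ^ I.height (h y) ≤ b * I.r ^ I.height k) :
    I.value k q b ≤
      ∑ y ∈ Finset.range q, ((I.height k : ℝ) - I.height (h y)) * I.weight y := by
  have hr : 0 < I.r := by have := I.two_le_r; omega
  induction k generalizing q b with
  | zero =>
    have h0 : ∀ y ∈ Finset.range q, h y = 0 := fun y hy => by
      have := hle y (Finset.mem_range.1 hy); omega
    rw [Finset.sum_congr rfl fun y hy => by rw [h0 y hy]] at hkraft
    rw [Finset.sum_congr rfl fun y hy => by rw [h0 y hy]]
    simp at hkraft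
    simp [value, hkraft]
  | succ k ihk =>
    induction q generalizing b with
    | zero => simp
    | succ q ihq =>
      rcases (hle q (by omega)).eq_or_lt with hqk | hqk
      · rw [Finset.sum_range_succ, hqk] at hkraft
        cases b with
        | zero =>
          have := pow_pos hr (I.height (k + 1))
          omega
        | succ b =>
          refine (I.value_le_left k q b).trans ?_
          rw [Finset.sum_range_succ, hqk, sub_self, zero_mul, add_zero]
          refine ihq (by omega) (fun y hy => hle y (by omega))
            (fun y z hyz hz => hmono y z hyz (by omega)) ?_
          rw [add_mul, one_mul] at hkraft
          omega
      · have hle' : ∀ y < q + 1, h y ≤ k := fun y hy => by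
          have := hmono y q (by omega) (by omega)
          omega
        refine (I.value_le_right k q b).trans ?_
        have key := ihk (by omega) hq (b := I.children (k + 1) b) hle' hmono ?_
        · refine (add_le_add_right key _).trans (le_of_eq ?_)
          rw [tailSum, Finset.mul_sum, ← Finset.sum_add_distrib]
          refine Finset.sum_congr rfl fun y _ => ?_
          rw [I.height_succ (by omega)]
          push_cast
          ring
        · rw [children, min_mul_of_nonneg _ _ (Nat.zero_le _)]
          refine le_min ?_ ?_
          · refine hkraft.trans (le_of_eq ?_)
            rw [I.height_succ (by omega), pow_add]
            ring
          · calc ∑ y ∈ Finset.range (q + 1), I.r ^ I.height (h y)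
                ≤ ∑ y ∈ Finset.range (q + 1), I.r ^ I.height k :=
                  Finset.sum_le_sum fun y hy => Nat.pow_le_pow_right hr
                    (I.height_mono (hle' y (Finset.mem_range.1 hy)))
              _ = (q + 1) * I.r ^ I.height k := by simp
              _ ≤ _ := Nat.mul_le_mul_right _ hq

lemma height_sub {i : ℕ} (hi : i ≤ I.g) : I.height (I.g - i) = I.γ I.g - I.γ i := by
  rw [height, Nat.sub_sub_self hi]

lemma height_g_sub {k : ℕ} : (I.height I.g : ℝ) - I.height k = I.γ (I.g - k) := by
  have := I.γ_mono (i := I.g - k) (j := I.g) (by omega) le_rfl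
  rw [height_g, height, Nat.cast_sub this]
  ring

lemma sum_range_eq_sum_rev {M : Type*} [AddCommMonoid M] (n : ℕ) (F : ℕ → M) :
    ∑ y ∈ Finset.range n, F y = ∑ j : Fin n, F j.rev := by
  rw [Finset.sum_range]
  exact (Equiv.sum_comp Fin.revPerm fun j : Fin n => F j).symm

lemma value_le_pathCost (hp : Antitone I.p) {T : LabelledTree I.n} (hT : I.Feasible T) :
    I.value I.g I.n 1 ≤ pathCost I.p T := by
  have H : ∀ j, ∃ i ≤ I.g, (T.leaf j).length = I.γ i := fun j => by
    obtain ⟨i, _, hi, hij⟩ := hT.2 ⟨j, rfl⟩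
    exact ⟨i, hi, hij⟩
  choose e heg he using H
  set σ := Tuple.sort e
  have hσ : Monotone (e ∘ σ) := Tuple.monotone_sort e
  let h : ℕ → ℕ := fun y => if hy : y < I.n then I.g - e (σ (Fin.rev ⟨y, hy⟩)) else 0
  have hh : ∀ j : Fin I.n, h j.rev = I.g - e (σ j) := fun j => by
    simp only [h, Fin.is_lt, dif_pos, Fin.eta, Fin.rev_rev]
  have key := I.value_le le_rfl le_rfl (b := 1) (h := h) ?_ ?_ ?_
  · refine key.trans ?_
    rw [sum_range_eq_sum_rev]
    have h1 : ∀ j : Fin I.n, ((I.height I.g : ℝ) - I.height (h j.rev)) * I.weight j.rev =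
        (I.γ (e (σ j)) : ℝ) * I.p j := fun j => by
      rw [hh, height_g_sub, weight_rev, Nat.sub_sub_self (heg _)]
    rw [Finset.sum_congr rfl fun j _ => h1 j]
    have hanti : Antivary (fun j => (I.γ (e (σ j)) : ℝ)) I.p := by
      refine Monotone.antivary (fun i j hij => ?_) hp
      exact Nat.cast_le.2 (I.γ_mono (hσ hij) (heg _))
    refine (hanti.sum_mul_le_sum_comp_perm_mul (σ := σ⁻¹)).trans (le_of_eq ?_)
    unfold pathCost
    refine Finset.sum_congr rfl fun j _ => ?_
    simp [he]
  · intro y hy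
    simp [h, hy]
  · intro y z hyz hz
    simp only [h, hz, hyz.trans_lt hz, dif_pos]
    have : e (σ (Fin.rev ⟨z, hz⟩)) ≤ e (σ (Fin.rev ⟨y, hyz.trans_lt hz⟩)) :=
      hσ (Fin.rev_le_rev.2 (by simpa using hyz))
    omega
  · rw [sum_range_eq_sum_rev, one_mul, height_g]
    have h1 : ∀ j : Fin I.n, I.r ^ I.height (h j.rev) =
        I.r ^ (I.γ I.g - (T.leaf (σ j)).length) := fun j => by
      rw [hh, I.height_sub (heg _), he]
    rw [Finset.sum_congr rfl fun j _ => h1 j,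
      Equiv.sum_comp σ fun j => I.r ^ (I.γ I.g - (T.leaf j).length)]
    exact kraft_le T hT.1 fun j => by rw [he]; exact I.γ_mono (heg j) le_rfl

lemma pathCost_lt_penalty {T : LabelledTree I.n} (hT : I.Feasible T) :
    pathCost I.p T < I.penalty := by
  have : pathCost I.p T ≤ I.γ I.g * I.tailSum I.n := by
    rw [tailSum, sum_range_eq_sum_rev, Finset.mul_sum, pathCost]
    refine Finset.sum_le_sum fun j _ => ?_
    rw [weight_rev]
    refine mul_le_mul_of_nonneg_right ?_ (I.p_nonneg j)
    obtain ⟨i, _, hi, hij⟩ := hT.2 ⟨j, rfl⟩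
    exact Nat.cast_le.2 (hij.trans_le (I.γ_mono hi le_rfl))
  unfold penalty
  linarith

/-- An optimal partial solution: the leaves `y` with `q ≤ y < n` (counted from the end) are placed
on the levels `γ_{g - h y}`, and `b` nodes remain free on level `γ_{g-k}`. -/
structure Partial (k q b : ℕ) (h : ℕ → ℕ) : Prop where
  k_le : k ≤ I.g
  q_le : q ≤ I.n
  b_le : b ≤ I.n
  le_h : ∀ y, q ≤ y → y < I.n → k ≤ h y
  h_le : ∀ y, q ≤ y → y < I.n → h y ≤ I.g
  h_mono : ∀ y z, q ≤ y → y ≤ z → z < I.n → h y ≤ h z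
  kraft : ∑ y ∈ Finset.Ico q I.n, I.r ^ I.height (h y) + b * I.r ^ I.height k ≤
    I.r ^ I.height I.g
  cost : ∑ y ∈ Finset.Ico q I.n, ((I.height I.g : ℝ) - I.height (h y)) * I.weight y +
    ((I.height I.g : ℝ) - I.height k) * I.tailSum q + I.value k q b = I.value I.g I.n 1
  lt : I.value k q b < I.penalty

variable {I}

lemma Partial.init (h : ℕ → ℕ) (hlt : I.value I.g I.n 1 < I.penalty) :
    I.Partial I.g I.n 1 h := by
  have := I.two_le_n
  exact ⟨le_rfl, le_rfl, by omega, fun y _ _ => by omega, fun y _ _ => by omega,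
    fun y z _ _ _ => by omega, by simp, by simp, hlt⟩

lemma value_eq_left {k q b : ℕ} (h : I.value k q b ≤ I.value k (q + 1) (b + 1)) :
    I.value k (q + 1) (b + 1) = I.value k q b := by
  cases k with
  | zero => simp [value]
  | succ k => exact le_antisymm (I.value_le_left k q b) h

lemma sum_Ico_update {M : Type*} [AddCommMonoid M] {q n : ℕ} (hq : q < n) (h : ℕ → ℕ) (k : ℕ)
    (F : ℕ → ℕ → M) : ∑ y ∈ Finset.Ico q n, F y (Function.update h q k y) =
      F q k + ∑ y ∈ Finset.Ico (q + 1) n, F y (h y) := by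
  rw [Finset.sum_eq_sum_Ico_succ_bot hq, Function.update_self]
  congr 1
  refine Finset.sum_congr rfl fun y hy => ?_
  rw [Function.update_of_ne (by have := (Finset.mem_Ico.1 hy).1; omega)]

lemma Partial.place {k q b : ℕ} {h : ℕ → ℕ} (H : I.Partial k (q + 1) (b + 1) h)
    (hv : I.value k q b ≤ I.value k (q + 1) (b + 1)) :
    I.Partial k q b (Function.update h q k) := by
  have hq : q < I.n := H.q_le
  have hup : ∀ y, q + 1 ≤ y → Function.update h q k y = h y := fun y hy =>
    Function.update_of_ne (by omega) _ _
  refine ⟨H.k_le, by omega, by have := H.b_le; omega, ?_, ?_, ?_, ?_, ?_, hv.trans_lt H.lt⟩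
  · intro y hy hyn
    rcases hy.eq_or_lt with rfl | hy
    · simp
    · rw [hup y hy]; exact H.le_h y hy hyn
  · intro y hy hyn
    rcases hy.eq_or_lt with rfl | hy
    · simpa using H.k_le
    · rw [hup y hy]; exact H.h_le y hy hyn
  · intro y z hy hyz hz
    rcases hyz.eq_or_lt with rfl | hyz
    · rfl
    · rw [hup z (by omega)]
      rcases hy.eq_or_lt with rfl | hy
      · simpa using H.le_h z hyz hz
      · rw [hup y hy]; exact H.h_mono y z hy hyz.le hz
  · rw [sum_Ico_update hq h k fun _ m => I.r ^ I.height m]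
    have := H.kraft
    rw [add_mul, one_mul] at this
    omega
  · rw [sum_Ico_update hq h k fun y m => ((I.height I.g : ℝ) - I.height m) * I.weight y]
    have := H.cost
    rw [I.tailSum_succ, value_eq_left hv] at this
    linarith

lemma Partial.descend {k q b : ℕ} {h : ℕ → ℕ} (H : I.Partial k (q + 1) b h)
    (hv : ¬ (1 ≤ b ∧ I.value k q (b - 1) ≤ I.value k (q + 1) b)) :
    1 ≤ k ∧ I.Partial (k - 1) (q + 1) (I.children k b) h := by
  cases k with
  | zero =>
    exfalso
    have hlt := H.lt
    simp only [value] at hlt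
    split_ifs at hlt with hqb
    · apply hv
      refine ⟨by omega, ?_⟩
      simp [value, hqb, show q ≤ b - 1 by omega]
    · exact lt_irrefl _ hlt
  | succ k =>
    have hval : I.value (k + 1) (q + 1) b =
        I.stepLen (k + 1) * I.tailSum (q + 1) + I.value k (q + 1) (I.children (k + 1) b) := by
      rw [value]
      rw [value] at hv
      split_ifs at hv ⊢ with hc
      · exact absurd ⟨hc.1, le_rfl⟩ hv
      · rfl
    have hk : k < I.g := H.k_le
    have hD := I.height_succ hk
    refine ⟨by omega, by simp; omega, H.q_le, min_le_right _ _,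
      fun y hy hyn => (Nat.sub_le _ _).trans (H.le_h y hy hyn), H.h_le, H.h_mono, ?_, ?_, ?_⟩
    · refine le_trans ?_ H.kraft
      rw [Nat.add_sub_cancel]
      refine Nat.add_le_add_left ?_ _
      rw [hD, pow_add, mul_comm (I.r ^ I.height k), ← mul_assoc]
      exact Nat.mul_le_mul_right _ (min_le_left _ _)
    · rw [Nat.add_sub_cancel]
      have := H.cost
      rw [hval, hD] at this
      push_cast at this
      linarith
    · rw [Nat.add_sub_cancel]
      have := H.lt
      have h2 : 0 ≤ (I.stepLen (k + 1) : ℝ) * I.tailSum (q + 1) :=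
        mul_nonneg (Nat.cast_nonneg _) (I.tailSum_nonneg _)
      rw [hval] at this
      linarith

lemma Partial.exists_optimal (hp : Antitone I.p) {k b : ℕ} {h : ℕ → ℕ} (H : I.Partial k 0 b h) :
    ∃ T T' : LabelledTree I.n, I.IsOptimalTree T ∧ I.IsOptimalGMR T' ∧ I.Corresponds T T' ∧
      (∀ i, 1 ≤ i → i ≤ I.g →
        leafCount T (I.γ i) = ((Finset.Ico 0 I.n).filter fun y => I.g - h y = i).card) ∧
      pathCost I.p T = I.value I.g I.n 1 := by
  have hn := I.two_le_n
  have hr : 0 < I.r := by have := I.two_le_r; omega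
  have hg : ∀ y < I.n, h y ≤ I.g := fun y => H.h_le y (by omega)
  have hlt : ∀ y < I.n, h y < I.g := by
    intro y hy
    refine lt_of_le_of_ne (hg y hy) fun hyg => ?_
    obtain ⟨z, hz, hzy⟩ : ∃ z < I.n, z ≠ y := by
      rcases Nat.eq_zero_or_pos y with rfl | hy0
      · exact ⟨1, by omega, by omega⟩
      · exact ⟨0, by omega, by omega⟩
    have h1 : ∑ x ∈ {y, z}, I.r ^ I.height (h x) ≤
        ∑ x ∈ Finset.Ico 0 I.n, I.r ^ I.height (h x) :=
      Finset.sum_le_sum_of_subset fun x hx => by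
        simp only [Finset.mem_insert, Finset.mem_singleton] at hx
        rcases hx with rfl | rfl <;> simpa
    rw [Finset.sum_pair hzy.symm, hyg] at h1
    have h2 := H.kraft
    have h3 := pow_pos hr (I.height (h z))
    omega
  obtain ⟨T, hT, hTl⟩ := exists_tree_of_kraft (n := I.n) (r := I.r) (L := I.γ I.g)
    (l := fun j => I.γ (I.g - h j.rev)) (by omega) hr
    (fun i j hij => I.γ_mono (by
      have := H.h_mono j.rev i.rev (by omega) (Fin.rev_le_rev.2 hij) (Fin.is_lt _)
      omega) (by omega))
    (fun j => I.γ_mono (by omega) le_rfl) (by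
      have := H.kraft
      rw [← Finset.range_eq_Ico, sum_range_eq_sum_rev, height_g] at this
      unfold height at this
      omega)
  have hfeas : I.Feasible T := by
    refine ⟨hT, ?_⟩
    rintro _ ⟨j, rfl⟩
    have := hlt j.rev (Fin.is_lt _)
    exact ⟨I.g - h j.rev, by omega, by omega, hTl j⟩
  have hcost : pathCost I.p T = I.value I.g I.n 1 := by
    rw [← H.cost, ← Finset.range_eq_Ico, sum_range_eq_sum_rev]
    simp only [tailSum, Finset.range_zero, Finset.sum_empty, mul_zero, add_zero, value_zero_right]
    refine Finset.sum_congr rfl fun j _ => ?_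
    rw [hTl, height_g_sub, weight_rev]
  have hopt : I.IsOptimalTree T :=
    ⟨hfeas, fun S hS => hcost.trans_le (I.value_le_pathCost hp hS)⟩
  obtain ⟨T', hT', hc⟩ := I.exists_gmr hfeas
  refine ⟨T, T', hopt, (hc.isOptimal_iff hfeas hT').1 hopt, hc, fun i hi hig => ?_, hcost⟩
  rw [leafCount, Finset.card_filter, Finset.card_filter, ← Finset.range_eq_Ico,
    sum_range_eq_sum_rev]
  refine Finset.sum_congr rfl fun j _ => ?_
  simp only [hTl, I.γ_inj (Nat.sub_le _ _) hig]

end Problem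

/-! ### Running programs -/

/-- `P`, started in `s`, halts within `T` steps in a state satisfying `Q`. -/
def Runs (P : Program) (s : State) (Q : State → Prop) (T : ℕ) : Prop :=
  ∃ s' t, Exec P s s' t ∧ t ≤ T ∧ Q s'

namespace Runs

variable {P P' : Program} {s : State} {Q Q' : State → Prop} {T T' : ℕ}

lemma mono (h : Runs P s Q T) (hQ : ∀ s', Q s' → Q' s') (hT : T ≤ T') : Runs P s Q' T' :=
  let ⟨s', t, h1, h2, h3⟩ := h
  ⟨s', t, h1, h2.trans hT, hQ s' h3⟩

lemma nop (h : Q s) : Runs .nop s Q 1 := ⟨s, 1, .nop s, le_rfl, h⟩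

lemma setNat {a : ℕ} {i e : NatExp} (h : Q (s.setNat a (i.eval s) (e.eval s))) :
    Runs (.setNat a i e) s Q (i.time + e.time + 1) := ⟨_, _, .setNat s a i e, le_rfl, h⟩

lemma setReal {a : ℕ} {i : NatExp} {e : RealExp} (h : Q (s.setReal a (i.eval s) (e.eval s))) :
    Runs (.setReal a i e) s Q (i.time + e.time + 1) := ⟨_, _, .setReal s a i e, le_rfl, h⟩

lemma seq (h : Runs P s Q T) (h' : ∀ s', Q s' → Runs P' s' Q' T') :
    Runs (.seq P P') s Q' (T + T') := by
  obtain ⟨s', t, h1, h2, h3⟩ := h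
  obtain ⟨s'', t', h1', h2', h3'⟩ := h' s' h3
  exact ⟨s'', t + t', .seq h1 h1', by omega, h3'⟩

lemma setNat_seq {a : ℕ} {i e : NatExp}
    (h : Runs P (s.setNat a (i.eval s) (e.eval s)) Q T) :
    Runs (.seq (.setNat a i e) P) s Q (i.time + e.time + 1 + T) :=
  (setNat (Q := (· = _)) rfl).seq fun _ hs => hs ▸ h

lemma setReal_seq {a : ℕ} {i : NatExp} {e : RealExp}
    (h : Runs P (s.setReal a (i.eval s) (e.eval s)) Q T) :
    Runs (.seq (.setReal a i e) P) s Q (i.time + e.time + 1 + T) :=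
  (setReal (Q := (· = _)) rfl).seq fun _ hs => hs ▸ h

lemma branch {b : Test} (h : b.Holds s → Runs P s Q T) (h' : ¬ b.Holds s → Runs P' s Q T') :
    Runs (.branch b P P') s Q (b.time + 1 + (T + T')) := by
  by_cases hb : b.Holds s
  · obtain ⟨s', t, h1, h2, h3⟩ := h hb
    exact ⟨s', _, .branch_true hb h1, by omega, h3⟩
  · obtain ⟨s', t, h1, h2, h3⟩ := h' hb
    exact ⟨s', _, .branch_false hb h1, by omega, h3⟩

lemma loop {b : Test} {B : ℕ} (Inv : ℕ → State → Prop)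
    (hb : ∀ j s, Inv j s → (b.Holds s ↔ j < B))
    (hP : ∀ j < B, ∀ s, Inv j s → Runs P s (Inv (j + 1)) T) (hs : Inv 0 s) :
    Runs (.loop b P) s (Inv B) (B * (b.time + 1 + T) + b.time + 1) := by
  suffices H : ∀ m j s, j + m = B → Inv j s →
      Runs (.loop b P) s (Inv B) (m * (b.time + 1 + T) + b.time + 1) from H B 0 s (by omega) hs
  intro m
  induction m with
  | zero =>
    intro j s hj h
    obtain rfl : j = B := by omega
    exact ⟨s, _, .loop_false (by simp [hb j s h]), by omega, h⟩
  | succ m ih =>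
    intro j s hj h
    obtain ⟨s', t, h1, h2, h3⟩ := hP j (by omega) s h
    obtain ⟨s'', t', h1', h2', h3'⟩ := ih (j + 1) s' (by omega) h3
    refine ⟨s'', _, .loop_true ((hb j s h).2 (by omega)) h1 h1', ?_, h3'⟩
    rw [add_mul]
    omega

end Runs

/-- The scalar kept in cell `0` of array `a`. -/
abbrev scalar (a : ℕ) : NatExp := .get a (.const 0)

/-- `for a = 0, …, N - 1 do P`. -/
def forLoop (a : ℕ) (N : NatExp) (P : Program) : Program :=
  .seq (.setNat a (.const 0) (.const 0))
    (.loop (.natLe (.add (scalar a) (.const 1)) N)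
      (.seq P (.setNat a (.const 0) (.add (scalar a) (.const 1)))))

lemma Runs.forLoop {a : ℕ} {N : NatExp} {P : Program} {s : State} {B T : ℕ}
    (Inv : ℕ → State → Prop) (hN : ∀ j s, Inv j s → s.nat a 0 = j ∧ N.eval s = B)
    (hs : Inv 0 (s.setNat a 0 0))
    (hP : ∀ j < B, ∀ s, Inv j s →
      Runs P s (fun s' => Inv (j + 1) (s'.setNat a 0 (s'.nat a 0 + 1))) T) :
    Runs (forLoop a N P) s (Inv B) (B * (N.time + 12 + T) + N.time + 9) := by
  refine (Runs.setNat_seq (Runs.loop (T := T + 6) Inv ?_ ?_ hs)).mono (fun _ h => h) ?_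
  · intro j s h
    obtain ⟨h1, h2⟩ := hN j s h
    simp only [Test.Holds, NatExp.eval, h1, h2]
    omega
  · intro j hj s h
    exact (hP j hj s h).seq fun s' hs' => Runs.setNat hs'
  · simp only [Test.time, NatExp.time]
    have : B * (2 + 1 + 1 + N.time + 1 + 1 + (T + 6)) = B * (N.time + 12 + T) := by
      congr 1; omega
    simp only [show (1 : ℕ) + 1 = 2 from rfl]
    omega

section memory

variable (s : State) (a a' i k : ℕ) (x : ℝ)

@[simp] lemma State.setNat_real : (s.setNat a i k).real = s.real := rfl

@[simp] lemma State.setReal_nat : (s.setReal a i x).nat = s.nat := rfl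

@[simp] lemma State.setNat_nat_self : (s.setNat a i k).nat a = Function.update (s.nat a) i k := by
  simp [State.setNat]

@[simp] lemma State.setReal_real_self :
    (s.setReal a i x).real a = Function.update (s.real a) i x := by
  simp [State.setReal]

variable {a a'}

lemma State.setNat_nat_of_ne (h : a' ≠ a) : (s.setNat a i k).nat a' = s.nat a' := by
  simp [State.setNat, h]

lemma State.setReal_real_of_ne (h : a' ≠ a) : (s.setReal a i x).real a' = s.real a' := by
  simp [State.setReal, h]

end memory

/-! ### The program

Array `4` holds the products `min (j r) n`, and cell `0` of array `5` the number `(n + 1) ^ 2`. The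
table of the dynamic program is stored in array `2` of real numbers, and the numbers of children in
array `7`; the entry `(k, q, b)` has index `(k (n + 1) + q) (n + 1) + b`. Array `3` of real numbers
holds the tail sums and array `4` the penalty. The scalars are: `10`, `12`, `18` loop counters, `11`
the level `k`, `13` the arity, `14` the number `q` of leaves, `15` a number of children, `16` the
number `b` of nodes, `17` the index of the current entry. -/

abbrev rExp : NatExp := .get 0 (.const 0)
abbrev nExp : NatExp := .get 0 (.const 1)
abbrev gExp : NatExp := .get 0 (.const 2)
abbrev kExp : NatExp := scalar 11
abbrev arityExp : NatExp := scalar 13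
abbrev qExp : NatExp := scalar 14
abbrev tExp : NatExp := scalar 15
abbrev bExp : NatExp := scalar 16
abbrev xExp : NatExp := scalar 17

/-- `min e n`. -/
abbrev capExp (e : NatExp) : NatExp := .sub nExp (.sub nExp e)

abbrev stepExp : NatExp :=
  .sub (.get 1 (.add (.sub gExp kExp) (.const 1))) (.get 1 (.sub gExp kExp))

/-- The entry for one leaf and one node less. -/
abbrev leftExp : RealExp := .get 2 (.sub xExp (.add nExp (.const 2)))

/-- The value when all nodes of the current level become internal. -/
abbrev rightExp : RealExp :=
  .add (.mul (.ofNat stepExp) (.get 3 qExp))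
    (.get 2 (.add (.sub (.sub xExp bExp) (scalar 5)) tExp))

def tablesProgram : Program :=
  forLoop 10 (.add nExp (.const 1))
    (.seq (.setNat 4 (.add (scalar 10) (.const 1)) (capExp (.add (.get 4 (scalar 10)) rExp)))
    (.seq (.setNat 5 (.const 0) (.add (scalar 5) (.add nExp (.const 1))))
      (.setReal 3 (.add (scalar 10) (.const 1))
        (.add (.get 3 (scalar 10)) (.get 0 (.sub nExp (.add (scalar 10) (.const 1))))))))

def penaltyProgram : Program :=
  .seq (.setReal 4 (.const 0)
      (.add (.mul (.ofNat (.get 1 gExp)) (.get 3 nExp)) (.ofNat (.const 1))))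
    (.setNat 17 (.const 0) (.const 0))

def entryProgram : Program :=
  .branch (.natLe qExp (.const 0)) (.setReal 2 xExp (.ofNat (.const 0)))
    (.branch (.natLe kExp (.const 0))
      (.branch (.natLe qExp bExp) (.setReal 2 xExp (.ofNat (.const 0)))
        (.setReal 2 xExp (.get 4 (.const 0))))
      (.branch (.conj (.natLe (.const 1) bExp) (.realLe leftExp rightExp))
        (.setReal 2 xExp leftExp) (.setReal 2 xExp rightExp)))

def rowProgram : Program :=
  .seq (.setNat 15 (.const 0) (.const 0))
    (forLoop 16 (.add nExp (.const 1))
      (.seq entryProgram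
      (.seq (.setNat 7 xExp tExp)
      (.seq (.setNat 15 (.const 0) (capExp (.add tExp arityExp)))
        (.setNat 17 (.const 0) (.add xExp (.const 1)))))))

def arityProgram : Program :=
  .seq (.setNat 13 (.const 0) (.const 1))
    (forLoop 12 nExp
      (.branch (.natLe (.add (scalar 12) (.const 1)) stepExp)
        (.setNat 13 (.const 0) (.get 4 arityExp)) .nop))

def fillProgram : Program :=
  forLoop 11 (.add gExp (.const 1))
    (.seq arityProgram (forLoop 14 (.add nExp (.const 1)) rowProgram))

def placeProgram : Program :=
  .seq (.setNat 3 (.sub gExp kExp) (.add (.get 3 (.sub gExp kExp)) (.const 1)))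
  (.seq (.setNat 17 (.const 0) (.sub xExp (.add nExp (.const 2))))
  (.seq (.setNat 14 (.const 0) (.sub qExp (.const 1)))
    (.setNat 16 (.const 0) (.sub bExp (.const 1)))))

def descendProgram : Program :=
  .seq (.setNat 15 (.const 0) (.get 7 xExp))
  (.seq (.setNat 17 (.const 0) (.add (.sub (.sub xExp bExp) (scalar 5)) tExp))
  (.seq (.setNat 16 (.const 0) tExp)
    (.setNat 11 (.const 0) (.sub kExp (.const 1)))))

def traceProgram : Program :=
  .seq (.setNat 2 (.const 0) (.const 1))
  (.seq (.setNat 11 (.const 0) gExp)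
  (.seq (.setNat 14 (.const 0) nExp)
  (.seq (.setNat 16 (.const 0) (.const 1))
    (forLoop 18 (.add gExp nExp)
      (.branch (.natLe qExp (.const 0)) .nop
        (.branch (.conj (.natLe (.const 1) bExp) (.realLe leftExp (.get 2 xExp)))
          placeProgram descendProgram))))))

def outputProgram : Program :=
  .seq (.setNat 17 (.const 0) (.sub xExp nExp))
  (.seq (.setReal 1 (.const 0) (.get 2 xExp))
    (.branch (.realLe (.get 4 (.const 0)) (.get 2 xExp)) .nop traceProgram))

def solveProgram : Program :=
  .seq tablesProgram (.seq penaltyProgram (.seq fillProgram outputProgram))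

namespace Problem

variable (I : Problem)

/-- The index of the table entry `(k, q, b)`. -/
def idx (k q b : ℕ) : ℕ := (k * (I.n + 1) + q) * (I.n + 1) + b

lemma idx_inj {k q b k' q' b' : ℕ} (hq : q ≤ I.n) (hb : b ≤ I.n) (hq' : q' ≤ I.n) (hb' : b' ≤ I.n)
    (h : I.idx k q b = I.idx k' q' b') : k = k' ∧ q = q' ∧ b = b' := by
  have key : ∀ x y x' y' : ℕ, y ≤ I.n → y' ≤ I.n →
      x * (I.n + 1) + y = x' * (I.n + 1) + y' → x = x' ∧ y = y' := by
    intro x y x' y' hy hy' h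
    have h1 : x = x' := by
      have := congrArg (· / (I.n + 1)) h
      simpa [mul_comm _ (I.n + 1), Nat.mul_add_div, Nat.div_eq_of_lt (Nat.lt_succ_of_le hy),
        Nat.div_eq_of_lt (Nat.lt_succ_of_le hy')] using this
    subst h1
    exact ⟨rfl, by omega⟩
  obtain ⟨h1, h2⟩ := key _ _ _ _ hb hb' h
  obtain ⟨h3, h4⟩ := key _ _ _ _ hq hq' h1
  exact ⟨h3, h4, h2⟩

lemma idx_row_end (k q : ℕ) : I.idx k q (I.n + 1) = I.idx k (q + 1) 0 := by unfold idx; ring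

lemma idx_level_end (k : ℕ) : I.idx k (I.n + 1) 0 = I.idx (k + 1) 0 0 := by unfold idx; ring

lemma idx_left (k q b : ℕ) : I.idx k (q + 1) (b + 1) = I.idx k q b + (I.n + 2) := by
  unfold idx; ring

lemma idx_right (k q b : ℕ) :
    I.idx (k + 1) q b = I.idx k q 0 + b + (I.n + 1) * (I.n + 1) := by unfold idx; ring

lemma idx_add (k q b : ℕ) : I.idx k q b = I.idx k q 0 + b := rfl

/-- The inputs are unchanged and the auxiliary tables have been computed. -/
structure Core (s : State) : Prop where
  params : s.nat 0 = I.input.nat 0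
  lengths : s.nat 1 = I.input.nat 1
  products : ∀ j ≤ I.n, s.nat 4 j = min (j * I.r) I.n
  square : s.nat 5 0 = (I.n + 1) * (I.n + 1)
  sums : ∀ q ≤ I.n, s.real 3 q = I.tailSum q
  penalty_eq : s.real 4 0 = I.penalty

/-- The table has been filled below the index `N`. -/
def Filled (s : State) (N : ℕ) : Prop :=
  ∀ k q b, q ≤ I.n → b ≤ I.n → I.idx k q b < N →
    s.real 2 (I.idx k q b) = I.value k q b ∧ s.nat 7 (I.idx k q b) = I.children k b

/-- No output has been written yet. -/
def Clean (s : State) : Prop := s.nat 2 0 = 0 ∧ ∀ l, s.nat 3 l = 0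

variable {I} {s : State}

lemma Core.setNat (h : I.Core s) {a : ℕ} (i v : ℕ) (h0 : 0 ≠ a) (h1 : 1 ≠ a) (h4 : 4 ≠ a)
    (h5 : 5 ≠ a) : I.Core (s.setNat a i v) where
  params := by rw [s.setNat_nat_of_ne _ _ h0]; exact h.params
  lengths := by rw [s.setNat_nat_of_ne _ _ h1]; exact h.lengths
  products := by rw [s.setNat_nat_of_ne _ _ h4]; exact h.products
  square := by rw [s.setNat_nat_of_ne _ _ h5]; exact h.square
  sums := h.sums
  penalty_eq := h.penalty_eq

lemma Core.setReal (h : I.Core s) {a : ℕ} (i : ℕ) (v : ℝ) (h3 : 3 ≠ a) (h4 : 4 ≠ a) :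
    I.Core (s.setReal a i v) where
  params := h.params
  lengths := h.lengths
  products := h.products
  square := h.square
  sums := by rw [s.setReal_real_of_ne _ _ h3]; exact h.sums
  penalty_eq := by rw [s.setReal_real_of_ne _ _ h4]; exact h.penalty_eq

lemma Filled.setNat {N : ℕ} (h : I.Filled s N) {a : ℕ} (i v : ℕ) (h7 : 7 ≠ a) :
    I.Filled (s.setNat a i v) N := by
  unfold Filled
  rw [s.setNat_nat_of_ne _ _ h7]
  exact h

lemma Filled.setReal {N : ℕ} (h : I.Filled s N) {a : ℕ} (i : ℕ) (v : ℝ) (h2 : 2 ≠ a) :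
    I.Filled (s.setReal a i v) N := by
  unfold Filled
  rw [s.setReal_real_of_ne _ _ h2]
  exact h

lemma Filled.extend {k q b : ℕ} (hq : q ≤ I.n) (hb : b ≤ I.n) (h : I.Filled s (I.idx k q b)) :
    I.Filled ((s.setReal 2 (I.idx k q b) (I.value k q b)).setNat 7 (I.idx k q b)
      (I.children k b)) (I.idx k q (b + 1)) := by
  intro k' q' b' hq' hb' hlt
  have hlt' : I.idx k' q' b' ≤ I.idx k q b := Nat.lt_succ_iff.1 hlt
  rcases hlt'.eq_or_lt with he | hl
  · obtain ⟨rfl, rfl, rfl⟩ := I.idx_inj hq' hb' hq hb he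
    simp
  · simpa [hl.ne] using h k' q' b' hq' hb' hl

lemma Clean.setNat (h : Clean s) {a : ℕ} (i v : ℕ) (h2 : 2 ≠ a) (h3 : 3 ≠ a) :
    Clean (s.setNat a i v) := by
  unfold Clean
  rw [s.setNat_nat_of_ne _ _ h2, s.setNat_nat_of_ne _ _ h3]
  exact h

lemma Clean.setReal (h : Clean s) {a : ℕ} (i : ℕ) (v : ℝ) : Clean (s.setReal a i v) := h

lemma Core.eval_n (h : I.Core s) : nExp.eval s = I.n := by
  simp [NatExp.eval, h.params, input]

lemma Core.eval_g (h : I.Core s) : gExp.eval s = I.g := by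
  simp [NatExp.eval, h.params, input]

lemma Core.eval_step (h : I.Core s) {k : ℕ} (hk : s.nat 11 0 = k) :
    stepExp.eval s = I.stepLen k := by
  simp [NatExp.eval, h.params, h.lengths, hk, stepLen, input]

/-! ### The auxiliary tables -/

lemma runs_tablesProgram : Runs tablesProgram I.input (fun s =>
    s.nat 0 = I.input.nat 0 ∧ s.nat 1 = I.input.nat 1 ∧
    (∀ j ≤ I.n, s.nat 4 j = min (j * I.r) I.n) ∧ s.nat 5 0 = (I.n + 1) * (I.n + 1) ∧
    (∀ q ≤ I.n, s.real 3 q = I.tailSum q) ∧ Clean s) ((I.n + 1) * 80 + 13) := by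
  refine (Runs.forLoop (B := I.n + 1) (T := 60) (fun j s => s.nat 10 0 = j ∧
    s.nat 0 = I.input.nat 0 ∧ s.nat 1 = I.input.nat 1 ∧ s.real 0 = I.input.real 0 ∧
    (∀ i ≤ j, s.nat 4 i = min (i * I.r) I.n) ∧ s.nat 5 0 = j * (I.n + 1) ∧
    (∀ q ≤ j, s.real 3 q = I.tailSum q) ∧ Clean s) ?_ ?_ ?_).mono ?_ ?_
  · rintro j s ⟨h1, h2, -⟩
    exact ⟨h1, by simp [NatExp.eval, h2, input]⟩
  · simp [State.setNat_nat_of_ne, input, tailSum, Clean]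
  · rintro j - s ⟨h1, h2, h3, h4, h5, h6, h7, h8⟩
    have hn : s.nat 0 1 = I.n := by simp [h2, input]
    have hr : s.nat 0 0 = I.r := by simp [h2, input]
    refine (Runs.setNat_seq (Runs.setNat_seq (Runs.setReal ?_))).mono (fun _ h => h) (by decide)
    simp only [NatExp.eval, RealExp.eval, State.setNat_real, State.setReal_nat,
      State.setNat_nat_self, State.setReal_real_self, ne_eq, not_false_eq_true, State.setNat_nat_of_ne, State.setReal_real_of_ne, Nat.reduceEqDiff,
      OfNat.zero_ne_ofNat, OfNat.one_ne_ofNat, h1, h2, h3, h4, hn, hr, Function.update_self]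
    refine ⟨trivial, trivial, trivial, trivial, ?_, ?_, ?_, h8⟩
    · intro i hi
      rcases hi.eq_or_lt with rfl | hi
      · rw [Function.update_self, h5 j le_rfl, add_mul, one_mul]
        omega
      · rw [Function.update_of_ne hi.ne, h5 i (by omega)]
    · rw [h6]; ring
    · intro i hi
      rcases hi.eq_or_lt with rfl | hi
      · rw [Function.update_self, h7 j le_rfl, tailSum_succ, weight]
      · rw [Function.update_of_ne hi.ne, h7 i (by omega)]
  · rintro s ⟨-, h2, h3, -, h5, h6, h7, h8⟩
    exact ⟨h2, h3, fun j hj => h5 j (by omega), h6, fun j hj => h7 j (by omega), h8⟩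
  · simp [NatExp.time]

/-- The state of the computation before the entry with index `x` is filled. -/
structure Filling (I : Problem) (x : ℕ) (s : State) : Prop where
  core : I.Core s
  clean : Clean s
  x_eq : s.nat 17 0 = x
  filled : I.Filled s x

lemma Filling.setNat {x : ℕ} (h : I.Filling x s) {a : ℕ} (i v : ℕ) (ha : 8 ≤ a) (ha' : 17 ≠ a) :
    I.Filling x (s.setNat a i v) where
  core := h.core.setNat _ _ (by omega) (by omega) (by omega) (by omega)
  clean := h.clean.setNat _ _ (by omega) (by omega)
  x_eq := by rw [s.setNat_nat_of_ne _ _ ha']; exact h.x_eq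
  filled := h.filled.setNat _ _ (by omega)

lemma runs_penaltyProgram (h0 : s.nat 0 = I.input.nat 0) (h1 : s.nat 1 = I.input.nat 1)
    (h4 : ∀ j ≤ I.n, s.nat 4 j = min (j * I.r) I.n) (h5 : s.nat 5 0 = (I.n + 1) * (I.n + 1))
    (h3 : ∀ q ≤ I.n, s.real 3 q = I.tailSum q) (hc : Clean s) :
    Runs penaltyProgram s (I.Filling 0) 20 := by
  refine (Runs.setReal_seq (Runs.setNat ?_)).mono (fun _ h => h) (by decide)
  refine ⟨?_, (hc.setReal _ _).setNat _ _ (by decide) (by decide), by simp [NatExp.eval],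
    fun k q b _ _ h => absurd h (by omega)⟩
  refine Core.setNat (s := s.setReal 4 _ _) (a := 17) ⟨h0, h1, h4, h5, ?_, ?_⟩ _ _
    (by decide) (by decide) (by decide) (by decide)
  · simpa [State.setReal_real_of_ne] using h3
  · have hn : s.nat 0 1 = I.n := by simp [h0, input]
    have hg : s.nat 0 2 = I.g := by simp [h0, input]
    simp [NatExp.eval, RealExp.eval, hn, hg, h1, I.input_nat_one, h3, penalty]

/-! ### Filling the table -/

lemma min_min_mul {a m n : ℕ} (hm : 1 ≤ m) : min (min a n * m) n = min (a * m) n := by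
  rcases le_total a n with h | h
  · rw [min_eq_left h]
  · rw [min_eq_right h, min_eq_right (Nat.le_mul_of_pos_right n hm),
      min_eq_right (h.trans (Nat.le_mul_of_pos_right a hm))]

lemma runs_arityProgram {k x : ℕ} (h : I.Filling x s) (hk : s.nat 11 0 = k) :
    Runs arityProgram s (fun s => I.Filling x s ∧ s.nat 11 0 = k ∧
      s.nat 13 0 = min (I.r ^ I.stepLen k) I.n) (I.n * 70 + 20) := by
  have hn := I.two_le_n
  have hr := I.two_le_r
  refine (Runs.setNat_seq (Runs.forLoop (B := I.n) (T := 40) (fun j s => I.Filling x s ∧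
    s.nat 11 0 = k ∧ s.nat 12 0 = j ∧
    s.nat 13 0 = min (I.r ^ min j (I.stepLen k)) I.n) ?_ ?_ ?_)).mono ?_ ?_
  · rintro j s ⟨h1, -, h3, -⟩
    exact ⟨h3, h1.core.eval_n⟩
  · refine ⟨(h.setNat _ _ (by decide) (by decide)).setNat _ _ (by decide) (by decide), ?_⟩
    simp [State.setNat_nat_of_ne, NatExp.eval, hk]
    omega
  · rintro j - s ⟨h1, h2, h3, h4⟩
    refine (Runs.branch (T := 5) (T' := 1) (fun hb => Runs.setNat ?_)
      (fun hb => Runs.nop ?_)).mono (fun _ h => h) (by decide)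
    · simp only [Test.Holds, h1.core.eval_step h2] at hb
      simp only [NatExp.eval, h3] at hb
      refine ⟨(h1.setNat _ _ (by decide) (by decide)).setNat _ _ (by decide) (by decide), ?_⟩
      simp only [NatExp.eval, h4, h1.core.products _ (min_le_right _ _)]
      simp only [State.setNat_nat_self, ne_eq, not_false_eq_true,
        State.setNat_nat_of_ne, Nat.reduceEqDiff, Function.update_self, h2, h3, true_and]
      rw [min_min_mul (by omega), ← pow_succ, min_eq_left (show j ≤ _ by omega), min_eq_left hb]
    · simp only [Test.Holds, h1.core.eval_step h2] at hb
      simp only [NatExp.eval, h3] at hb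
      refine ⟨h1.setNat _ _ (by decide) (by decide), ?_⟩
      simp only [State.setNat_nat_self, ne_eq, not_false_eq_true,
        State.setNat_nat_of_ne, Nat.reduceEqDiff, Function.update_self, h2, h3, h4, true_and]
      rw [min_eq_right (show _ ≤ j by omega), min_eq_right (show _ ≤ j + 1 by omega)]
  · rintro s ⟨h1, h2, -, h4⟩
    refine ⟨h1, h2, h4.trans ?_⟩
    rcases le_total I.n (I.stepLen k) with hc | hc
    · have h5 := (Nat.lt_pow_self (n := I.n) (a := I.r) (by omega)).le
      rw [min_eq_left hc, min_eq_right h5,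
        min_eq_right (h5.trans (Nat.pow_le_pow_right (by omega) hc))]
    · rw [min_eq_right hc]
  · simp [NatExp.time]
    omega

lemma runs_entryProgram {k q b : ℕ} (hq : q ≤ I.n) (hb : b ≤ I.n)
    (h : I.Filling (I.idx k q b) s) (hk : s.nat 11 0 = k) (hqs : s.nat 14 0 = q)
    (ht : s.nat 15 0 = I.children k b) (hbs : s.nat 16 0 = b) :
    Runs entryProgram s (· = s.setReal 2 (I.idx k q b) (I.value k q b)) 220 := by
  have hx : xExp.eval s = I.idx k q b := h.x_eq
  have hq' : qExp.eval s = q := hqs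
  have hk' : kExp.eval s = k := hk
  have hb' : bExp.eval s = b := hbs
  have hset : ∀ {e : RealExp}, e.eval s = I.value k q b → Runs (.setReal 2 xExp e) s
      (· = s.setReal 2 (I.idx k q b) (I.value k q b)) (xExp.time + e.time + 1) := fun he =>
    Runs.setReal (by rw [hx, he])
  refine (Runs.branch (fun h1 => hset ?_) fun h1 => Runs.branch
    (fun h2 => Runs.branch (fun h3 => hset ?_) fun h3 => hset ?_)
    (fun h2 => Runs.branch (fun h3 => hset ?_) fun h3 => hset ?_)).mono (fun _ h => h) (by decide)
  all_goals simp only [Test.Holds, hqs, NatExp.eval] at h1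
  · obtain rfl : q = 0 := by omega
    simp [RealExp.eval, NatExp.eval]
  all_goals simp only [Test.Holds, hq', hk', hb'] at h2 h3
  all_goals simp only [NatExp.eval] at h2
  · obtain rfl : k = 0 := by omega
    simp [RealExp.eval, NatExp.eval, value, h3]
  · obtain rfl : k = 0 := by omega
    simp [RealExp.eval, NatExp.eval, value, h3, h.core.penalty_eq]
  all_goals
    obtain ⟨k, rfl⟩ := Nat.exists_eq_succ_of_ne_zero (show k ≠ 0 by omega)
    obtain ⟨q, rfl⟩ := Nat.exists_eq_succ_of_ne_zero (show q ≠ 0 by omega)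
    simp only [Nat.succ_eq_add_one] at *
    have hleft : 1 ≤ b → leftExp.eval s = I.value (k + 1) q (b - 1) := by
      intro hb1
      obtain ⟨b, rfl⟩ := Nat.exists_eq_succ_of_ne_zero (show b ≠ 0 by omega)
      have hn : s.nat 0 1 = I.n := h.core.eval_n
      have h5 := I.idx_left (k + 1) q b
      simp only [Nat.succ_eq_add_one] at *
      simp only [RealExp.eval, NatExp.eval, h.x_eq, hn, h5, Nat.add_sub_cancel]
      exact (h.filled (k + 1) q b (by omega) (by omega) (by omega)).1
    have hright : rightExp.eval s = I.stepLen (k + 1) * I.tailSum (q + 1) +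
        I.value k (q + 1) (I.children (k + 1) b) := by
      have hch : I.children (k + 1) b ≤ I.n := min_le_right _ _
      have h5 := I.idx_right k (q + 1) b
      have h6 := I.idx_add k (q + 1) (I.children (k + 1) b)
      have h7 : (NatExp.add (.sub (.sub xExp bExp) (scalar 5)) tExp).eval s =
          I.idx k (q + 1) (I.children (k + 1) b) := by
        simp only [NatExp.eval, h.x_eq, hbs, h.core.square, ht]
        omega
      have h8 : I.idx k (q + 1) (I.children (k + 1) b) < I.idx (k + 1) (q + 1) b := by
        have : I.n + 1 ≤ (I.n + 1) * (I.n + 1) := Nat.le_mul_of_pos_right _ (by omega)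
        omega
      rw [RealExp.eval, RealExp.eval, RealExp.eval, RealExp.eval, RealExp.eval, h7,
        h.core.eval_step hk, hq', h.core.sums _ hq, (h.filled _ _ _ hq hch h8).1]
    rw [value]
    simp only [NatExp.eval, hright] at h3
  · rw [hleft h3.1] at h3 ⊢
    rw [if_pos h3]
  · rw [hright, if_neg]
    rintro ⟨h6, h7⟩
    exact h3 ⟨h6, (hleft h6).trans_le h7⟩

lemma runs_rowProgram {k q : ℕ} (hq : q ≤ I.n) (h : I.Filling (I.idx k q 0) s)
    (hk : s.nat 11 0 = k) (hR : s.nat 13 0 = min (I.r ^ I.stepLen k) I.n) (hqs : s.nat 14 0 = q) :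
    Runs rowProgram s (fun s => I.Filling (I.idx k (q + 1) 0) s ∧ s.nat 11 0 = k ∧
      s.nat 13 0 = min (I.r ^ I.stepLen k) I.n ∧ s.nat 14 0 = q) ((I.n + 1) * 300 + 20) := by
  refine (Runs.setNat_seq (Runs.forLoop (B := I.n + 1) (T := 270) (fun j s =>
    I.Filling (I.idx k q j) s ∧ s.nat 11 0 = k ∧ s.nat 13 0 = min (I.r ^ I.stepLen k) I.n ∧
    s.nat 14 0 = q ∧ s.nat 15 0 = I.children k j ∧ s.nat 16 0 = j) ?_ ?_ ?_)).mono ?_ ?_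
  · rintro j s ⟨h1, -, -, -, -, h2⟩
    exact ⟨h2, congrArg (· + 1) h1.core.eval_n⟩
  · refine ⟨(h.setNat _ _ (by decide) (by decide)).setNat _ _ (by decide) (by decide), ?_⟩
    simp [State.setNat_nat_of_ne, NatExp.eval, hk, hR, hqs, children]
  · rintro b hb s ⟨h, hk, hR, hqs, ht, hbs⟩
    refine ((runs_entryProgram hq (by omega) h hk hqs ht hbs).seq fun s' hs' =>
      Runs.setNat_seq (Runs.setNat_seq (Runs.setNat ?_))).mono (fun _ h => h) (by decide)
    have hn : s.nat 0 1 = I.n := h.core.eval_n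
    have hfill := Filled.extend hq (show b ≤ I.n by omega) h.filled
    subst hs'
    simp only [NatExp.eval, State.setReal_nat,
      State.setNat_nat_self, ne_eq, not_false_eq_true, State.setNat_nat_of_ne, Nat.reduceEqDiff,
      OfNat.zero_ne_ofNat, h.x_eq, hk, hR, hqs, ht, hbs, hn,
      Function.update_self]
    refine ⟨⟨?_, ?_, ?_, ?_⟩, trivial, trivial, trivial, ?_, trivial⟩
    · refine Core.setNat (Core.setNat (Core.setNat (Core.setNat (h.core.setReal _ _ ?_ ?_)
        _ _ ?_ ?_ ?_ ?_) _ _ ?_ ?_ ?_ ?_) _ _ ?_ ?_ ?_ ?_) _ _ ?_ ?_ ?_ ?_ <;> decide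
    · refine Clean.setNat (Clean.setNat (Clean.setNat (Clean.setNat (h.clean.setReal _ _)
        _ _ ?_ ?_) _ _ ?_ ?_) _ _ ?_ ?_) _ _ ?_ ?_ <;> decide
    · simp [State.setNat_nat_of_ne, idx, add_assoc]
    · exact ((hfill.setNat _ _ (by decide)).setNat _ _ (by decide)).setNat _ _ (by decide)
    · simp only [children, add_mul, one_mul]
      omega
  · rintro s ⟨h, hk, hR, hqs, -, -⟩
    exact ⟨I.idx_row_end k q ▸ h, hk, hR, hqs⟩
  · simp [NatExp.time]
    omega

lemma runs_fillProgram (h : I.Filling 0 s) : Runs fillProgram s (I.Filling (I.idx (I.g + 1) 0 0))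
    ((I.g + 1) * ((I.n + 1) * ((I.n + 1) * 300 + 50) + I.n * 70 + 70) + 20) := by
  refine (Runs.forLoop (B := I.g + 1)
    (T := I.n * 70 + 20 + ((I.n + 1) * ((I.n + 1) * 300 + 50) + 15)) (fun k s =>
    I.Filling (I.idx k 0 0) s ∧ s.nat 11 0 = k) ?_ ?_ ?_).mono (fun _ h => h.1) ?_
  · rintro j s ⟨h1, h2⟩
    exact ⟨h2, congrArg (· + 1) h1.core.eval_g⟩
  · exact ⟨by simpa [idx] using h.setNat 0 0 (by decide) (by decide), by simp⟩
  · rintro k - s ⟨h, hk⟩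
    refine (runs_arityProgram h hk).seq fun s ⟨h, hk, hR⟩ => ?_
    refine (Runs.forLoop (B := I.n + 1) (T := (I.n + 1) * 300 + 20) (fun q s =>
      I.Filling (I.idx k q 0) s ∧ s.nat 11 0 = k ∧
      s.nat 13 0 = min (I.r ^ I.stepLen k) I.n ∧ s.nat 14 0 = q) ?_ ?_ ?_).mono ?_ ?_
    · rintro j s ⟨h1, -, -, h2⟩
      exact ⟨h2, congrArg (· + 1) h1.core.eval_n⟩
    · exact ⟨h.setNat _ _ (by decide) (by decide), by simp [State.setNat_nat_of_ne, hk, hR]⟩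
    · rintro q hq s ⟨h, hk, hR, hqs⟩
      refine (runs_rowProgram (by omega) h hk hR hqs).mono ?_ le_rfl
      rintro s ⟨h, hk, hR, hqs⟩
      exact ⟨h.setNat _ _ (by decide) (by decide),
        by simp [State.setNat_nat_of_ne, hk, hR, hqs]⟩
    · rintro s ⟨h, hk, -, -⟩
      rw [I.idx_level_end] at h
      exact ⟨h.setNat _ _ (by decide) (by decide), by simp [hk]⟩
    · simp only [NatExp.time]
      nlinarith
  · simp only [NatExp.time]
    nlinarith

/-! ### Reading off an optimal solution -/

/-- The invariant of the trace through the table. -/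
structure Tracing (I : Problem) (u k q b : ℕ) (h : ℕ → ℕ) (s : State) : Prop where
  core : I.Core s
  filled : I.Filled s (I.idx (I.g + 1) 0 0)
  u_eq : s.nat 18 0 = u
  k_eq : s.nat 11 0 = k
  q_eq : s.nat 14 0 = q
  b_eq : s.nat 16 0 = b
  x_eq : s.nat 17 0 = I.idx k q b
  part : I.Partial k q b h
  progress : q = 0 ∨ k + q + u = I.g + I.n
  flag : s.nat 2 0 = 1
  cost : s.real 1 0 = I.value I.g I.n 1
  count : ∀ l, s.nat 3 l = ((Finset.Ico q I.n).filter fun y => I.g - h y = l).card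

lemma idx_lt {k q b : ℕ} (hk : k ≤ I.g) (hq : q ≤ I.n) (hb : b ≤ I.n) :
    I.idx k q b < I.idx (I.g + 1) 0 0 := by
  unfold idx
  have h1 : k * (I.n + 1) + q + 1 ≤ (I.g + 1) * (I.n + 1) := by nlinarith
  nlinarith

lemma card_filter_update {k q n : ℕ} (hq : q < n) (h : ℕ → ℕ) (g l : ℕ) :
    ((Finset.Ico q n).filter fun y => g - Function.update h q k y = l).card =
      ((Finset.Ico (q + 1) n).filter fun y => g - h y = l).card + if g - k = l then 1 else 0 := by
  rw [Finset.card_filter, Finset.card_filter,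
    sum_Ico_update hq h k fun _ m => if g - m = l then 1 else 0, add_comm]

lemma Tracing.runs_placeProgram {u k q b : ℕ} {h : ℕ → ℕ} (H : I.Tracing u k (q + 1) (b + 1) h s)
    (hv : I.value k q b ≤ I.value k (q + 1) (b + 1)) :
    Runs placeProgram s (fun s => ∃ h', I.Tracing (u + 1) k q b h'
      (s.setNat 18 0 (s.nat 18 0 + 1))) 60 := by
  refine (Runs.setNat_seq (Runs.setNat_seq (Runs.setNat_seq (Runs.setNat
    ⟨Function.update h q k, ?_⟩)))).mono (fun _ h => h) (by decide)
  have hn : s.nat 0 1 = I.n := H.core.eval_n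
  have hg : s.nat 0 2 = I.g := H.core.eval_g
  simp only [NatExp.eval, ne_eq, not_false_eq_true,
    State.setNat_nat_of_ne, Nat.reduceEqDiff, OfNat.zero_ne_ofNat, H.x_eq, H.k_eq, H.q_eq, H.b_eq,
    H.u_eq, hn, hg, I.idx_left, Nat.add_sub_cancel]
  constructor
  · refine Core.setNat (Core.setNat (Core.setNat (Core.setNat (Core.setNat H.core
        _ _ ?_ ?_ ?_ ?_) _ _ ?_ ?_ ?_ ?_) _ _ ?_ ?_ ?_ ?_) _ _ ?_ ?_ ?_ ?_) _ _ ?_ ?_ ?_ ?_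
        <;> decide
  · refine Filled.setNat (Filled.setNat (Filled.setNat (Filled.setNat (Filled.setNat H.filled
        _ _ ?_) _ _ ?_) _ _ ?_) _ _ ?_) _ _ ?_ <;> decide
  · simp
  · simp [State.setNat_nat_of_ne, H.k_eq]
  · simp [State.setNat_nat_of_ne]
  · simp [State.setNat_nat_of_ne]
  · simp [State.setNat_nat_of_ne]
  · exact H.part.place hv
  · have := H.progress
    omega
  · simp [State.setNat_nat_of_ne, H.flag]
  · exact H.cost
  · intro l
    rw [card_filter_update H.part.q_le, ← H.count]
    simp only [State.setNat_nat_self, ne_eq, not_false_eq_true,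
      State.setNat_nat_of_ne, Nat.reduceEqDiff]
    by_cases hl : I.g - k = l
    · subst hl; simp
    · simp [hl, Function.update_of_ne (Ne.symm hl)]

lemma Tracing.runs_descendProgram {u k q b : ℕ} {h : ℕ → ℕ} (H : I.Tracing u k (q + 1) b h s)
    (hv : ¬ (1 ≤ b ∧ I.value k q (b - 1) ≤ I.value k (q + 1) b)) :
    Runs descendProgram s (fun s => I.Tracing (u + 1) (k - 1) (q + 1) (I.children k b) h
      (s.setNat 18 0 (s.nat 18 0 + 1))) 60 := by
  refine (Runs.setNat_seq (Runs.setNat_seq (Runs.setNat_seq (Runs.setNat ?_)))).mono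
    (fun _ h => h) (by decide)
  obtain ⟨hk, hpart⟩ := H.part.descend hv
  have ht := (H.filled _ _ _ H.part.q_le H.part.b_le
    (idx_lt H.part.k_le H.part.q_le H.part.b_le)).2
  simp only [NatExp.eval, State.setNat_nat_self, ne_eq, not_false_eq_true,
    State.setNat_nat_of_ne, Nat.reduceEqDiff, H.x_eq, H.k_eq, H.b_eq,
    H.u_eq, ht, Function.update_self, H.core.square]
  constructor
  · refine Core.setNat (Core.setNat (Core.setNat (Core.setNat (Core.setNat H.core
        _ _ ?_ ?_ ?_ ?_) _ _ ?_ ?_ ?_ ?_) _ _ ?_ ?_ ?_ ?_) _ _ ?_ ?_ ?_ ?_) _ _ ?_ ?_ ?_ ?_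
        <;> decide
  · refine Filled.setNat (Filled.setNat (Filled.setNat (Filled.setNat (Filled.setNat H.filled
        _ _ ?_) _ _ ?_) _ _ ?_) _ _ ?_) _ _ ?_ <;> decide
  · simp
  · simp [State.setNat_nat_of_ne]
  · simp [State.setNat_nat_of_ne, H.q_eq]
  · simp [State.setNat_nat_of_ne]
  · simp only [State.setNat_nat_self, ne_eq, not_false_eq_true,
      State.setNat_nat_of_ne, Nat.reduceEqDiff, Function.update_self]
    obtain ⟨k, rfl⟩ := Nat.exists_eq_succ_of_ne_zero (show k ≠ 0 by omega)
    have h1 := I.idx_right k (q + 1) b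
    have h2 := I.idx_add k (q + 1) (I.children (k + 1) b)
    simp only [Nat.succ_eq_add_one, Nat.add_sub_cancel]
    omega
  · exact hpart
  · have := H.progress
    omega
  · simp [State.setNat_nat_of_ne, H.flag]
  · exact H.cost
  · simpa [State.setNat_nat_of_ne] using H.count

lemma runs_traceProgram (hc : I.Core s) (hcl : Clean s) (hf : I.Filled s (I.idx (I.g + 1) 0 0))
    (hx : s.nat 17 0 = I.idx I.g I.n 1) (hcost : s.real 1 0 = I.value I.g I.n 1)
    (hlt : I.value I.g I.n 1 < I.penalty) :
    Runs traceProgram s (fun s => ∃ k b h, I.Tracing (I.g + I.n) k 0 b h s)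
      ((I.g + I.n) * 200 + 60) := by
  refine (Runs.setNat_seq (Runs.setNat_seq (Runs.setNat_seq (Runs.setNat_seq
    (Runs.forLoop (B := I.g + I.n) (T := 170) (fun u s => ∃ k q b h, I.Tracing u k q b h s)
      ?_ ?_ ?_))))).mono ?_ ?_
  · rintro u s ⟨k, q, b, h, H⟩
    exact ⟨H.u_eq, congrArg₂ (· + ·) H.core.eval_g H.core.eval_n⟩
  · refine ⟨I.g, I.n, 1, fun _ => 0, ?_⟩
    have hn : s.nat 0 1 = I.n := hc.eval_n
    have hg : s.nat 0 2 = I.g := hc.eval_g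
    simp only [NatExp.eval, ne_eq, not_false_eq_true,
      State.setNat_nat_of_ne, OfNat.zero_ne_ofNat, hn, hg]
    constructor
    · refine Core.setNat (Core.setNat (Core.setNat (Core.setNat (Core.setNat hc
        _ _ ?_ ?_ ?_ ?_) _ _ ?_ ?_ ?_ ?_) _ _ ?_ ?_ ?_ ?_) _ _ ?_ ?_ ?_ ?_) _ _ ?_ ?_ ?_ ?_
        <;> decide
    · refine Filled.setNat (Filled.setNat (Filled.setNat (Filled.setNat (Filled.setNat hf
        _ _ ?_) _ _ ?_) _ _ ?_) _ _ ?_) _ _ ?_ <;> decide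
    · simp
    · simp [State.setNat_nat_of_ne]
    · simp [State.setNat_nat_of_ne]
    · simp [State.setNat_nat_of_ne]
    · simp [State.setNat_nat_of_ne, hx]
    · exact .init _ hlt
    · right; rfl
    · simp [State.setNat_nat_of_ne]
    · exact hcost
    · simp [State.setNat_nat_of_ne, hcl.2]
  · rintro u - s ⟨k, q, b, h, H⟩
    have hb : bExp.eval s = b := H.b_eq
    have hcur : (RealExp.get 2 xExp).eval s = I.value k q b := by
      simp only [RealExp.eval, NatExp.eval, H.x_eq]
      exact (H.filled _ _ _ H.part.q_le H.part.b_le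
        (idx_lt H.part.k_le H.part.q_le H.part.b_le)).1
    refine (Runs.branch (fun h1 => Runs.nop ?_) fun h1 => Runs.branch (T := 60) (T' := 60)
      (fun h2 => ?_) (fun h2 => ?_)).mono (fun _ h => h) (by decide)
    · simp only [Test.Holds, H.q_eq, NatExp.eval] at h1
      obtain rfl : q = 0 := by omega
      refine ⟨k, 0, b, h, ?_⟩
      exact ⟨H.core.setNat _ _ (by decide) (by decide) (by decide) (by decide),
        H.filled.setNat _ _ (by decide), by simp [H.u_eq], H.k_eq, H.q_eq, H.b_eq, H.x_eq, H.part,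
        .inl rfl, H.flag, H.cost, H.count⟩
    all_goals
      simp only [Test.Holds, H.q_eq, NatExp.eval] at h1
      obtain ⟨q, rfl⟩ := Nat.exists_eq_succ_of_ne_zero (show q ≠ 0 by omega)
      simp only [Nat.succ_eq_add_one] at *
      have hleft : 1 ≤ b → leftExp.eval s = I.value k q (b - 1) := by
        intro hb1
        have hk := H.part.k_le
        have hqn := H.part.q_le
        have hbn := H.part.b_le
        obtain ⟨b, rfl⟩ := Nat.exists_eq_succ_of_ne_zero (show b ≠ 0 by omega)
        simp only [Nat.succ_eq_add_one] at *
        have hn : s.nat 0 1 = I.n := H.core.eval_n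
        simp only [RealExp.eval, NatExp.eval, H.x_eq, hn, I.idx_left, Nat.add_sub_cancel]
        exact (H.filled k q b (by omega) (by omega) (idx_lt hk (by omega) (by omega))).1
      simp only [Test.Holds, hb, hcur] at h2
      rw [NatExp.eval] at h2
    · rw [hleft h2.1] at h2
      obtain ⟨b, rfl⟩ := Nat.exists_eq_succ_of_ne_zero (show b ≠ 0 by omega)
      refine (H.runs_placeProgram h2.2).mono ?_ le_rfl
      rintro s ⟨h', H'⟩
      exact ⟨_, _, _, _, H'⟩
    · refine (H.runs_descendProgram fun h3 => h2 ⟨h3.1, (hleft h3.1).trans_le h3.2⟩).mono ?_ le_rfl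
      intro s H'
      exact ⟨_, _, _, _, H'⟩
  · rintro s ⟨k, q, b, h, H⟩
    obtain rfl : q = 0 := by
      have := H.progress
      omega
    exact ⟨k, b, h, H⟩
  · simp only [NatExp.time]
    omega

lemma runs_outputProgram (hp : Antitone I.p) (h : I.Filling (I.idx (I.g + 1) 0 0) s) :
    Runs outputProgram s I.Solved ((I.g + I.n) * 200 + 100) := by
  have hn : s.nat 0 1 = I.n := h.core.eval_n
  have hn2 := I.two_le_n
  have hx : I.idx (I.g + 1) 0 0 - I.n = I.idx I.g I.n 1 := by
    have h1 := I.idx_level_end I.g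
    have h2 := I.idx_row_end I.g I.n
    have h3 := I.idx_add I.g I.n 1
    have h4 := I.idx_add I.g I.n (I.n + 1)
    omega
  have hval : s.real 2 (I.idx I.g I.n 1) = I.value I.g I.n 1 :=
    (h.filled _ _ _ le_rfl (by omega) (idx_lt le_rfl le_rfl (by omega))).1
  refine (Runs.setNat_seq (Runs.setReal_seq (Runs.branch (T := 1)
    (T' := (I.g + I.n) * 200 + 60) (fun hb => Runs.nop ?_) fun hb => ?_))).mono (fun _ h => h) ?_
  · left
    simp [Test.Holds, NatExp.eval, RealExp.eval, h.x_eq, hn, hx, State.setReal_real_of_ne, hval,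
      h.core.penalty_eq] at hb
    constructor
    · rintro ⟨T, hT⟩
      have h1 := I.value_le_pathCost hp hT
      have h2 := I.pathCost_lt_penalty hT
      linarith
    · simpa [State.setNat_nat_of_ne] using h.clean.1
  · simp [Test.Holds, NatExp.eval, RealExp.eval, h.x_eq, hn, hx, State.setReal_real_of_ne, hval,
      h.core.penalty_eq] at hb
    refine (runs_traceProgram ?_ ?_ ?_ ?_ ?_ hb).mono ?_ le_rfl
    · exact (h.core.setNat _ _ (by decide) (by decide) (by decide) (by decide)).setReal _ _
        (by decide) (by decide)
    · exact (h.clean.setNat _ _ (by decide) (by decide)).setReal _ _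
    · exact (h.filled.setNat _ _ (by decide)).setReal _ _ (by decide)
    · simp [NatExp.eval, h.x_eq, hn, hx]
    · simp [NatExp.eval, RealExp.eval, h.x_eq, hn, hx, hval]
    · rintro s' ⟨k, b, f, H⟩
      obtain ⟨T, T', h1, h2, h3, h4, h5⟩ := H.part.exists_optimal hp
      refine .inr ⟨H.flag, T, T', h1, h2, h3, fun i hi hig => ?_, H.cost.trans h5.symm⟩
      rw [← h3.leafCount_eq hig, h4 i hi hig, H.count]
      exact ⟨rfl, rfl⟩
  · simp only [NatExp.time, RealExp.time, Test.time]
    omega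

lemma runs_solveProgram (hp : Antitone I.p) :
    Runs solveProgram I.input I.Solved (10000 * (I.g * I.n ^ 2)) := by
  refine (runs_tablesProgram.seq fun s ⟨h0, h1, h4, h5, h3, hc⟩ =>
    (runs_penaltyProgram h0 h1 h4 h5 h3 hc).seq fun s h =>
      (runs_fillProgram h).seq fun s h => runs_outputProgram hp h).mono (fun _ h => h) ?_
  have hn := I.two_le_n
  have hg := I.one_le_g
  obtain ⟨m, hm⟩ := Nat.exists_eq_add_of_le hn
  obtain ⟨l, hl⟩ := Nat.exists_eq_add_of_le hg
  rw [hm, hl]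
  ring_nf
  nlinarith [Nat.zero_le (l * m), Nat.zero_le (l * m ^ 2), Nat.zero_le (m ^ 2)]

end Problem

end ReservedLength

end

open ReservedLength in
/-- Optimal trees for the given-lengths reserved-length problem correspond, at equal cost, to
optimal GMR trees with `r_i = r ^ (γ_i - γ_{i-1})` and `c_i = γ_i - γ_{i-1}`, and one program solves
the problem, for weights given in non-increasing order, in time `O(g n ^ 2)`. -/
theorem mainTheorem3 :
    (∀ I : Problem,
      (∀ T, I.Feasible T → ∃ T', IsGMR I.arity T' ∧ I.Corresponds T T') ∧
      (∀ T', IsGMR I.arity T' → ∃ T, I.Feasible T ∧ I.Corresponds T T') ∧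
      (∀ T T', I.Feasible T → IsGMR I.arity T' → I.Corresponds T T' →
        pathCost I.p T = gmrCost I.edgeLength I.p T' ∧
        (I.IsOptimalTree T ↔ I.IsOptimalGMR T'))) ∧
    (∃ (P : Program) (K : ℕ), ∀ I : Problem, Antitone I.p →
      ∃ (s : State) (t : ℕ), Exec P I.input s t ∧ t ≤ K * (I.g * I.n ^ 2) ∧ I.Solved s) :=
  ⟨fun I => ⟨fun _ => I.exists_gmr, fun _ => I.exists_feasible,
    fun _ _ hT hT' h => ⟨h.cost_eq, h.isOptimal_iff hT hT'⟩⟩,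
    solveProgram, 10000, fun _ hp => Problem.runs_solveProgram hp⟩
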